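/- Let $V=\mathbb C^3$, identify $V^*\otimes V$ with the space of complex $3\times 3$ matrices, and let $S^3(V^*\otimes V)$ be the space of symmetric tensors of order three. Write $m^{(3)}=m\otimes m\otimes m$. Let $sM_{\langle 3\rangle}\in S^3(V^*\otimes V)$ be the symmetrized matrix multiplication tensor, i.e. the tensor that corresponds, via the trace pairing, to the symmetric trilinear form $(A,B,C)\mapsto \frac12(\operatorname{tr}(ABC)+\operatorname{tr}(ACB))$. Let $\zeta=e^{2\pi i/3}$ and $a=-2^{1/3}$, and let $E_{kl}$ denote the matrix units. Consider two families of nine matrices indexed by $\mathbb F_3^2$. The first is $$\begin{array}{lll} P_{00}=\begin{pmatrix}1&-1&0\\-1&1&0\\0&0&0\end{pmatrix}& P_{01}=\begin{pmatrix}0&0&0\\0&1&-\zeta\\0&-\zeta^2&1\end{pmatrix}& P_{02}=\begin{pmatrix}1&0&-\zeta\\0&0&0\\-\zeta^2&0&1\end{pmatrix}\\ P_{10}=\begin{pmatrix}0&0&0\\0&1&-\zeta^2\\0&-\zeta&1\end{pmatrix}& P_{11}=\begin{pmatrix}1&0&-1\\0&0&0\\-1&0&1\end{pmatrix}& P_{12}=\begin{pmatrix}1&-\zeta&0\\-\zeta^2&1&0\\0&0&0\end{pmatrix}\\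 P_{20}=\begin{pmatrix}1&0&-\zeta^2\\0&0&0\\-\zeta&0&1\end{pmatrix}& P_{21}=\begin{pmatrix}1&-\zeta^2&0\\-\zeta&1&0\\0&0&0\end{pmatrix}& P_{22}=\begin{pmatrix}0&0&0\\0&1&-1\\0&-1&1\end{pmatrix} \end{array}$$ and the second is $$\begin{array}{lll} Q_{00}=aI,& Q_{01}=E_{12}+\zeta E_{23}+\zeta^2E_{31},& Q_{02}=E_{13}+\zeta^2E_{21}+\zeta E_{32},\\ Q_{10}=E_{12}+\zeta^2E_{23}+\zeta E_{31},& Q_{11}=E_{13}+E_{21}+E_{32},& Q_{12}=\operatorname{diag}(1,\zeta,\zeta^2),\\ Q_{20}=E_{13}+\zeta E_{21}+\zeta^2E_{32},& Q_{21}=\operatorname{diag}(1,\zeta^2,\zeta),& Q_{22}=E_{12}+E_{23}+E_{31}. \end{array}$$ Let $S=\{P_x^{(3)}\}\cup\{Q_x^{(3)}\}\subset S^3(V^*\otimes V)$. The group $\Gamma=GL(V^*\otimes V)$ acts on $S^3(V^*\otimes V)$ by $g\mapsto g\otimes g\otimes g$. Let $\Gamma_{sM_{\langle 3\rangle}}$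 be the group of those transformations of $S^3(V^*\otimes V)$ induced by elements of $\Gamma$ that fix $sM_{\langle 3\rangle}$, and let $\Gamma_S\le\Gamma_{sM_{\langle 3\rangle}}$ be the subgroup of those that map $S$ onto itself. The group $PGL(V)$ acts on $V^*\otimes V$ by conjugation. **Theorem.** The set $S$ has $18$ elements, $\Gamma_S$ has order $432$, and there is an isomorphism $$\Phi:\ (\mathbb Z_3^2\rtimes SL(2,\mathbb F_3))\rtimes\mathbb Z_2\ \longrightarrow\ \Gamma_S .$$ Here $\mathbb Z_3^2\rtimes SL(2,\mathbb F_3)$ is the group of affine transformations $x\mapsto Mx+v$ of $\mathbb F_3^2$ with $\det M=1$, and the generator of $\mathbb Z_2$ acts on it by conjugation with the interchange of the two coordinates of $\mathbb F_3^2$. The isomorphism can be chosen such that: 1. the image of $\mathbb Z_3^2\rtimes SL(2,\mathbb F_3)$ consists exactly of the elements of $\Gamma_S$ that are induced by elements of $PGL(V)$; 2. the generator of $\mathbb Z_2$ is mapped to the transformation induced by matrix transposition; 3. the affine transformation $x\mapsto Mx+v$ is mapped to an element of $\Gamma_S$ that sends $P_x^{(3)}$ to $P_{Mx+v}^{(3)}$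 and $Q_x^{(3)}$ to $Q_{Mx}^{(3)}$ for all $x\in\mathbb F_3^2$. Moreover, the matrices $P_x$ have rank one and their column spaces form the Hesse configuration in $\mathbb P(V)$: they are nine distinct points, and for distinct $x,y,z\in\mathbb F_3^2$ the points with labels $x,y,z$ are collinear if and only if $x+y+z=0$, i.e. if and only if $x,y,z$ form a line of the affine plane $\mathbb F_3^2$. -/

import Mathlib

open scoped TensorProduct MatrixGroups Pointwise
open Matrix

noncomputable section

/-! ### Symmetric tensors of order three -/

section SymmetricTensors

variable (W : Type) [AddCommGroup W] [Module ℂ W]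

/-- `S³ W`, the space of symmetric tensors inside `W ⊗ W ⊗ W`: the tensors that are fixed by all
permutations of the three factors. -/
def Sym3 : Submodule ℂ (⨂[ℂ] _ : Fin 3, W) where
  carrier := {t | ∀ σ : Equiv.Perm (Fin 3), PiTensorProduct.reindex ℂ (fun _ => W) σ t = t}
  add_mem' := by
    intro a b ha hb σ
    rw [map_add, ha σ, hb σ]
  zero_mem' := by
    intro σ
    rw [map_zero]
  smul_mem' := by
    intro c a ha σ
    rw [map_smul, ha σ]

variable {W}

/-- The cube `w⁽³⁾ = w ⊗ w ⊗ w`, as an element of `S³ W`. -/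
def cube (w : W) : Sym3 W :=
  ⟨PiTensorProduct.tprod ℂ (fun _ : Fin 3 => w), fun σ => by
    rw [PiTensorProduct.reindex_tprod]⟩

/-- The symmetrization `(1/6) ∑_σ σ t` of a tensor `t` of order three. -/
def symmetrize (t : ⨂[ℂ] _ : Fin 3, W) : Sym3 W :=
  ⟨(1 / 6 : ℂ) • ∑ σ : Equiv.Perm (Fin 3), PiTensorProduct.reindex ℂ (fun _ => W) σ t, fun τ => by
    rw [map_smul, map_sum]
    congr 1
    refine Fintype.sum_equiv (Equiv.mulLeft τ) _ _ fun σ => ?_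
    exact PiTensorProduct.reindex_reindex σ τ t⟩

theorem map_mem_Sym3 (g : W ≃ₗ[ℂ] W) {t : ⨂[ℂ] _ : Fin 3, W} (ht : t ∈ Sym3 W) :
    PiTensorProduct.map (fun _ => (g : W →ₗ[ℂ] W)) t ∈ Sym3 W := fun σ => by
  have h := PiTensorProduct.map_reindex (R := ℂ) (s := fun _ : Fin 3 => W)
    (t := fun _ : Fin 3 => W) (fun _ => (g : W →ₗ[ℂ] W)) σ t
  rw [ht σ] at h
  exact h.symm

theorem map_map_cancel (g h : W ≃ₗ[ℂ] W) (hgh : g * h = 1) (t : ⨂[ℂ] _ : Fin 3, W) :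
    PiTensorProduct.map (fun _ => (g : W →ₗ[ℂ] W))
      (PiTensorProduct.map (fun _ => (h : W →ₗ[ℂ] W)) t) = t := by
  rw [← LinearMap.comp_apply, ← PiTensorProduct.map_comp]
  have e : (g : W →ₗ[ℂ] W) ∘ₗ (h : W →ₗ[ℂ] W) = LinearMap.id :=
    LinearMap.ext fun x => congrArg (fun f : W ≃ₗ[ℂ] W => f x) hgh
  rw [e, PiTensorProduct.map_id, LinearMap.id_apply]

variable (W)

/-- The natural action of `GL(W)` on `S³ W`: the automorphism `g` acts as `g ⊗ g ⊗ g`. -/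
def cubeAction : (W ≃ₗ[ℂ] W) →* (Sym3 W ≃ₗ[ℂ] Sym3 W) where
  toFun g :=
    { toFun := fun t => ⟨PiTensorProduct.map (fun _ => (g : W →ₗ[ℂ] W)) t.1, map_mem_Sym3 g t.2⟩
      map_add' := fun s t => Subtype.ext (map_add _ s.1 t.1)
      map_smul' := fun c t => Subtype.ext (map_smul _ c t.1)
      invFun := fun t =>
        ⟨PiTensorProduct.map (fun _ => ((g⁻¹ : W ≃ₗ[ℂ] W) : W →ₗ[ℂ] W)) t.1,
          map_mem_Sym3 g⁻¹ t.2⟩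
      left_inv := fun t => Subtype.ext (map_map_cancel g⁻¹ g (inv_mul_cancel g) t.1)
      right_inv := fun t => Subtype.ext (map_map_cancel g g⁻¹ (mul_inv_cancel g) t.1) }
  map_one' := by
    apply LinearEquiv.ext
    intro t
    apply Subtype.ext
    exact congrArg (fun f => f t.1) (PiTensorProduct.map_id (R := ℂ) (s := fun _ : Fin 3 => W))
  map_mul' g h := by
    apply LinearEquiv.ext
    intro t
    apply Subtype.ext
    exact congrArg (fun f => f t.1) (PiTensorProduct.map_comp
      (fun _ : Fin 3 => (g : W →ₗ[ℂ] W)) (fun _ : Fin 3 => (h : W →ₗ[ℂ] W)))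

/-- `g w⁽³⁾ = (g w)⁽³⁾`. -/
theorem cubeAction_cube (g : W ≃ₗ[ℂ] W) (w : W) : cubeAction W g (cube w) = cube (g w) :=
  Subtype.ext (PiTensorProduct.map_tprod _ _)

end SymmetricTensors

/-! ### The symmetrized matrix multiplication tensor and its stabilizer -/

section MatrixMultiplication

variable (n : ℕ)

/-- The space `V* ⊗ V = End V` for `V = ℂⁿ`, that is, the `n × n` complex matrices. -/
abbrev Mat : Type := Matrix (Fin n) (Fin n) ℂ

/-- The matrix multiplication tensor `M_⟨n⟩ = ∑ E_ij ⊗ E_jk ⊗ E_ki`. -/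
def matMulTensor : ⨂[ℂ] _ : Fin 3, Mat n :=
  ∑ i : Fin n, ∑ j : Fin n, ∑ k : Fin n,
    PiTensorProduct.tprod ℂ
      ![(Matrix.single i j 1 : Mat n), Matrix.single j k 1, Matrix.single k i 1]

/-- The symmetrized matrix multiplication tensor `sM_⟨n⟩ ∈ S³(V* ⊗ V)`. -/
def sM : Sym3 (Mat n) := symmetrize (matMulTensor n)

/-- Evaluation of a tensor in `(V* ⊗ V)^{⊗3}` as a trilinear form at three matrices `A 0, A 1, A 2`,
where `V* ⊗ V` is identified with its own dual by the trace: `X₀ ⊗ X₁ ⊗ X₂ ↦ ∏ tr (X_i (A i))`. -/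
def traceEval (A : Fin 3 → Mat n) : (⨂[ℂ] _ : Fin 3, Mat n) →ₗ[ℂ] ℂ :=
  PiTensorProduct.lift ((MultilinearMap.mkPiAlgebra ℂ (Fin 3) ℂ).compLinearMap
    (fun i => (Matrix.traceLinearMap (Fin n) ℂ ℂ).comp (LinearMap.mulRight ℂ (A i))))

variable {n}

theorem traceEval_tprod (A X : Fin 3 → Mat n) :
    traceEval n A (PiTensorProduct.tprod ℂ X) = ∏ i, (X i * A i).trace := by
  simp [traceEval]

theorem traceEval_matMulTensor (A : Fin 3 → Mat n) :
    traceEval n A (matMulTensor n) = (A 0 * A 2 * A 1).trace := by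
  have h : ∀ (i j : Fin n) (B : Mat n), (Matrix.single i j 1 * B).trace = B j i := by
    intro i j B
    rw [Matrix.trace_single_mul]
    simp
  simp only [matMulTensor, map_sum, traceEval_tprod, Fin.prod_univ_three, Matrix.cons_val, h]
  simp only [Matrix.trace, Matrix.diag, Matrix.mul_apply, Finset.sum_mul]
  rw [Finset.sum_comm]
  refine Finset.sum_congr rfl fun j _ => ?_
  rw [Finset.sum_comm]
  refine Finset.sum_congr rfl fun k _ => Finset.sum_congr rfl fun i _ => ?_
  ring

theorem traceEval_reindex (A : Fin 3 → Mat n) (σ : Equiv.Perm (Fin 3))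
    (t : ⨂[ℂ] _ : Fin 3, Mat n) :
    traceEval n A (PiTensorProduct.reindex ℂ (fun _ => Mat n) σ t) =
      traceEval n (fun i => A (σ i)) t := by
  have h : (traceEval n A).comp
      (PiTensorProduct.reindex ℂ (fun _ : Fin 3 => Mat n) σ).toLinearMap =
        traceEval n (fun i => A (σ i)) := by
    apply PiTensorProduct.ext
    apply MultilinearMap.ext
    intro X
    change traceEval n A (PiTensorProduct.reindex ℂ (fun _ => Mat n) σ
      (PiTensorProduct.tprod ℂ X)) = traceEval n (fun i => A (σ i)) (PiTensorProduct.tprod ℂ X)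
    rw [PiTensorProduct.reindex_tprod, traceEval_tprod, traceEval_tprod]
    exact (Fintype.prod_equiv σ _ _ fun i => by simp).symm
  exact congrArg (fun f => f t) h

/-- `sM_⟨n⟩` is the tensor of the symmetric form `(A, B, C) ↦ (tr (ABC) + tr (ACB)) / 2`. -/
theorem traceEval_sM (A B C : Mat n) :
    traceEval n ![A, B, C] (sM n).1 =
      1 / 2 * ((A * B * C).trace + (A * C * B).trace) := by
  have hu : (Finset.univ : Finset (Equiv.Perm (Fin 3))) =
      {1, Equiv.swap 0 1, Equiv.swap 0 2, Equiv.swap 1 2, Equiv.swap 0 1 * Equiv.swap 1 2,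
        Equiv.swap 1 2 * Equiv.swap 0 1} := by decide
  have h1 : (B * C * A).trace = (A * B * C).trace := Matrix.trace_mul_cycle B C A
  have h2 : (C * A * B).trace = (A * B * C).trace := (Matrix.trace_mul_cycle A B C).symm
  have h3 : (C * B * A).trace = (A * C * B).trace := Matrix.trace_mul_cycle C B A
  have h4 : (B * A * C).trace = (A * C * B).trace := (Matrix.trace_mul_cycle A C B).symm
  simp only [sM, symmetrize, map_smul, map_sum, traceEval_reindex, traceEval_matMulTensor]
  rw [hu, Finset.sum_insert (by decide), Finset.sum_insert (by decide),
    Finset.sum_insert (by decide), Finset.sum_insert (by decide), Finset.sum_insert (by decide),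
    Finset.sum_singleton]
  have e01 : (Equiv.swap (0 : Fin 3) 1) 2 = 2 := by decide
  have e02 : (Equiv.swap (0 : Fin 3) 2) 1 = 1 := by decide
  have e12 : (Equiv.swap (1 : Fin 3) 2) 0 = 0 := by decide
  simp [Equiv.Perm.mul_apply, e01, e02, e12, h1, h2, h3, h4]
  ring

/-- Conjugation `X ↦ P X P⁻¹`, the natural action of `GL(V)` on `V* ⊗ V`. -/
def conjGL : GL (Fin n) ℂ →* (Mat n ≃ₗ[ℂ] Mat n) where
  toFun P :=
    { toFun := fun X => P.1 * X * P⁻¹.1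
      map_add' := fun X Y => by rw [mul_add, add_mul]
      map_smul' := fun c X => by simp
      invFun := fun X => P⁻¹.1 * X * P.1
      left_inv := fun X => by
        simp only [mul_assoc, Units.inv_mul, mul_one, Units.inv_mul_cancel_left]
      right_inv := fun X => by
        simp only [mul_assoc, Units.mul_inv, mul_one, Units.mul_inv_cancel_left] }
  map_one' := by
    apply LinearEquiv.ext
    intro X
    change (1 : Mat n) * X * ((1 : GL (Fin n) ℂ)⁻¹).1 = X
    simp
  map_mul' P Q := by
    apply LinearEquiv.ext
    intro X
    change (P * Q).1 * X * (P * Q)⁻¹.1 = P.1 * (Q.1 * X * Q⁻¹.1) * P⁻¹.1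
    simp only [_root_.mul_inv_rev, Units.val_mul, mul_assoc]

/-- The natural action of `PGL(V)` on `V* ⊗ V` by conjugation. -/
def conjPGL : PGL(n, ℂ) →* (Mat n ≃ₗ[ℂ] Mat n) :=
  QuotientGroup.lift (Subgroup.center (GL (Fin n) ℂ)) conjGL fun P hP => by
    rw [Matrix.GeneralLinearGroup.center_eq_range_scalar] at hP
    obtain ⟨u, rfl⟩ := hP
    apply LinearEquiv.ext
    intro X
    change (Matrix.GeneralLinearGroup.scalar (Fin n) u).1 * X *
      (Matrix.GeneralLinearGroup.scalar (Fin n) u)⁻¹.1 = X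
    have hc : (Matrix.GeneralLinearGroup.scalar (Fin n) u).1 * X =
        X * (Matrix.GeneralLinearGroup.scalar (Fin n) u).1 := by
      ext i j
      simp [Matrix.GeneralLinearGroup.coe_scalar, mul_comm]
    rw [hc, mul_assoc, Units.mul_inv, mul_one]

variable (n)

/-- The group of transformations of `S³(V* ⊗ V)` coming from `PGL(V)`. -/
def pglSubgroup : Subgroup (Sym3 (Mat n) ≃ₗ[ℂ] Sym3 (Mat n)) :=
  ((cubeAction (Mat n)).comp conjPGL).range

/-- The transformation of `S³(V* ⊗ V)` induced by matrix transposition. -/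
def transposition : Sym3 (Mat n) ≃ₗ[ℂ] Sym3 (Mat n) :=
  cubeAction (Mat n) (Matrix.transposeLinearEquiv (Fin n) (Fin n) ℂ ℂ)

/-- The stabilizer `Γ_{sM_⟨n⟩}` of `sM_⟨n⟩` in the group of the transformations of `S³(V* ⊗ V)` that
are induced by elements of `Γ = GL(V* ⊗ V)`. -/
def stabilizerSM : Subgroup (Sym3 (Mat n) ≃ₗ[ℂ] Sym3 (Mat n)) :=
  (cubeAction (Mat n)).range ⊓ MulAction.stabilizer (Sym3 (Mat n) ≃ₗ[ℂ] Sym3 (Mat n)) (sM n)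

end MatrixMultiplication

/-! ### The decomposition -/

section Decomposition

/-- The primitive cube root of unity `ζ = exp (2πi/3)`. -/
def ζ₃ : ℂ := Complex.exp (2 * Real.pi * Complex.I / 3)

/-- The real number `a = -2^{1/3}`. -/
def aCoeff : ℂ := ((-(2 : ℝ) ^ (1 / 3 : ℝ) : ℝ) : ℂ)

/-- The label set `𝔽₃²` of a `3 × 3` block: the label `![i, j]` stands for the entry in row `i` and
column `j` of the block, counted from zero. -/
abbrev Label : Type := Fin 2 → ZMod 3

/-- The first block of nine matrices (those of rank one). -/
def firstBlock (x : Label) : Mat 3 :=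
  (![![!![1, -1, 0; -1, 1, 0; 0, 0, 0],
       !![0, 0, 0; 0, 1, -ζ₃; 0, -ζ₃ ^ 2, 1],
       !![1, 0, -ζ₃; 0, 0, 0; -ζ₃ ^ 2, 0, 1]],
     ![!![0, 0, 0; 0, 1, -ζ₃ ^ 2; 0, -ζ₃, 1],
       !![1, 0, -1; 0, 0, 0; -1, 0, 1],
       !![1, -ζ₃, 0; -ζ₃ ^ 2, 1, 0; 0, 0, 0]],
     ![!![1, 0, -ζ₃ ^ 2; 0, 0, 0; -ζ₃, 0, 1],
       !![1, -ζ₃ ^ 2, 0; -ζ₃, 1, 0; 0, 0, 0],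
       !![0, 0, 0; 0, 1, -1; 0, -1, 1]]] : Fin 3 → Fin 3 → Mat 3) (x 0) (x 1)

/-- The second block of nine matrices (those of rank three). -/
def secondBlock (x : Label) : Mat 3 :=
  (![![!![aCoeff, 0, 0; 0, aCoeff, 0; 0, 0, aCoeff],
       !![0, 1, 0; 0, 0, ζ₃; ζ₃ ^ 2, 0, 0],
       !![0, 0, 1; ζ₃ ^ 2, 0, 0; 0, ζ₃, 0]],
     ![!![0, 1, 0; 0, 0, ζ₃ ^ 2; ζ₃, 0, 0],
       !![0, 0, 1; 1, 0, 0; 0, 1, 0],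
       !![1, 0, 0; 0, ζ₃, 0; 0, 0, ζ₃ ^ 2]],
     ![!![0, 0, 1; ζ₃, 0, 0; 0, ζ₃ ^ 2, 0],
       !![1, 0, 0; 0, ζ₃ ^ 2, 0; 0, 0, ζ₃],
       !![0, 1, 0; 0, 0, 1; 1, 0, 0]]] : Fin 3 → Fin 3 → Mat 3) (x 0) (x 1)

/-- The set `S = {T₁, …, T₁₈}` of the cubes of the eighteen matrices. -/
def decompositionSet : Set (Sym3 (Mat 3)) :=
  Set.range (fun x => cube (firstBlock x)) ∪ Set.range (fun x => cube (secondBlock x))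

/-- The symmetry group `Γ_S` of the decomposition: the elements of the stabilizer of `sM_⟨3⟩` that
map the set `S` onto itself. -/
def GammaS : Subgroup (Sym3 (Mat 3) ≃ₗ[ℂ] Sym3 (Mat 3)) :=
  stabilizerSM 3 ⊓ MulAction.stabilizer (Sym3 (Mat 3) ≃ₗ[ℂ] Sym3 (Mat 3)) decompositionSet

/-- The column space of a matrix of the first block. -/
def columnSpace (x : Label) : Submodule ℂ (Fin 3 → ℂ) :=
  LinearMap.range (Matrix.toLin' (firstBlock x))

end Decomposition

/-! ### The abstract group `(ℤ₃² ⋊ SL(2, 𝔽₃)) ⋊ ℤ₂` -/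

section AbstractGroup

/-- The natural action of `SL(2, 𝔽₃)` on `ℤ₃² = 𝔽₃²` by `M, v ↦ M v`. -/
def slAction : SL(2, ZMod 3) →* MulAut (Multiplicative Label) where
  toFun M := AddEquiv.toMultiplicative (Matrix.SpecialLinearGroup.toLin' M).toAddEquiv
  map_one' := by
    rw [map_one]
    rfl
  map_mul' M N := by
    rw [map_mul]
    rfl

/-- The group `ℤ₃² ⋊ SL(2, 𝔽₃)` of affine transformations `x ↦ M x + v` of `𝔽₃²` with `det M = 1`. -/
abbrev AffineSL : Type := Multiplicative Label ⋊[slAction] SL(2, ZMod 3)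

/-- The affine transformation `x ↦ M x + v`. -/
def AffineSL.mk (v : Label) (M : SL(2, ZMod 3)) : AffineSL := ⟨Multiplicative.ofAdd v, M⟩

/-- The interchange of the two coordinates of `𝔽₃²`. -/
def swapLabel (x : Label) : Label := ![x 1, x 0]

/-- Conjugation of a matrix by the interchange of coordinates. -/
def swapSL (M : SL(2, ZMod 3)) : SL(2, ZMod 3) :=
  ⟨!![M 1 1, M 1 0; M 0 1, M 0 0], by
    have h := M.2
    rw [Matrix.det_fin_two] at h
    rw [Matrix.det_fin_two_of]
    linear_combination h⟩

theorem swapLabel_swapLabel (x : Label) : swapLabel (swapLabel x) = x := by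
  ext i
  fin_cases i <;> rfl

theorem swapSL_swapSL (M : SL(2, ZMod 3)) : swapSL (swapSL M) = M := by
  ext i j
  fin_cases i <;> fin_cases j <;> rfl

theorem swapSL_mul (M N : SL(2, ZMod 3)) : swapSL (M * N) = swapSL M * swapSL N := by
  apply Subtype.ext
  change !![(M.1 * N.1) 1 1, (M.1 * N.1) 1 0; (M.1 * N.1) 0 1, (M.1 * N.1) 0 0] =
    !![M.1 1 1, M.1 1 0; M.1 0 1, M.1 0 0] * !![N.1 1 1, N.1 1 0; N.1 0 1, N.1 0 0]
  rw [Matrix.mul_fin_two]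
  simp only [Matrix.mul_apply, Fin.sum_univ_two, add_comm]

theorem swapLabel_add_mulVec (M : SL(2, ZMod 3)) (v w : Label) :
    swapLabel (v + M.1 *ᵥ w) = swapLabel v + (swapSL M).1 *ᵥ swapLabel w := by
  ext i
  fin_cases i <;>
    simp [swapLabel, swapSL] <;> ring

/-- Conjugation by the interchange `s` of coordinates, as an automorphism of `ℤ₃² ⋊ SL(2, 𝔽₃)`:
it maps `x ↦ M x + v` to `x ↦ s (M (s x) + v)`. -/
def swapAut : MulAut AffineSL where
  toFun g := AffineSL.mk (swapLabel (Multiplicative.toAdd g.left)) (swapSL g.right)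
  invFun g := AffineSL.mk (swapLabel (Multiplicative.toAdd g.left)) (swapSL g.right)
  left_inv _ := SemidirectProduct.ext (swapLabel_swapLabel _) (swapSL_swapSL _)
  right_inv _ := SemidirectProduct.ext (swapLabel_swapLabel _) (swapSL_swapSL _)
  map_mul' g _ := SemidirectProduct.ext (swapLabel_add_mulVec g.right _ _) (swapSL_mul _ _)

theorem swapAut_sq : swapAut ^ 2 = 1 := by
  rw [pow_two]
  apply MulEquiv.ext
  intro g
  exact swapAut.left_inv g

/-- The action of `ℤ₂` on `ℤ₃² ⋊ SL(2, 𝔽₃)` whose generator acts as `swapAut`. -/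
def z2Action : Multiplicative (ZMod 2) →* MulAut AffineSL where
  toFun k := swapAut ^ (Multiplicative.toAdd k).val
  map_one' := pow_zero _
  map_mul' k l := by
    rw [toAdd_mul, ZMod.val_add, ← pow_add]
    exact (pow_eq_pow_mod _ swapAut_sq).symm

/-- The group `(ℤ₃² ⋊ SL(2, 𝔽₃)) ⋊ ℤ₂`. -/
abbrev HesseGroup : Type := AffineSL ⋊[z2Action] Multiplicative (ZMod 2)

end AbstractGroup

end

/-! The halves of the matrices P_x are nine equiangular rank-one projections (the Hesse SIC): tr
P_x² = 4, tr P_x P_y = 1 for x ≠ y, and tr P_x P_y P_z = -ω^(-[y-x, z-x]) for distinct labels, where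
[·,·] is the symplectic form `labelForm` on 𝔽₃². Hence the P_x are a basis of the matrix space with
sum 6·I, and every permutation of this basis is orthogonal for the trace form. It fixes sM_⟨3⟩
exactly when it preserves the sums ω^d + ω^(-d), d = [y-x, z-x], that is, the vanishing of d, which
is collinearity of labels. Such permutations are the affine maps of 𝔽₃². Since the only units of 𝔽₃
are ±1, they are generated by those of determinant one and the interchange of coordinates, which
acts as transposition.

Up to scalars, Q_x is the Fourier coefficient ∑ ω^[x,y] P_y. An affine map carries one such
coefficient to another times a cube root of unity, which cubing removes; so all these permutations
lie in Γ_S (`cubeRep_mem_GammaS`).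

Conversely, a linear map that fixes sM_⟨3⟩ sends I to a multiple c·I (`exists_map_one_eq_smul`), and
invariance of S gives c³ = 1. After division by c it fixes I and is orthogonal for the trace form
(`trace_map_mul_map`), so it preserves the trace. As tr P_x = 2 while the Q_x are traceless or
scalar, it must permute the P_x (`exists_eq_permRep`).

Conjugations preserve tr P_x P_y P_z itself and not only its symmetrization, so they preserve the
area [y-x, z-x] with its sign: determinant one. In the other direction, Weyl operators realize the
translations, and two shear operators realize generators of SL(2, 𝔽₃).

The identities between explicit matrices live in ℤ[ω], where they are finite exact computations, and
are carried to ℂ by `eisensteinHom`. -/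

noncomputable section

/-! ### Arithmetic in the Eisenstein integers -/

section Eisenstein

/-- The ring `ℤ[ω]` of Eisenstein integers, with `ω² = -1 - ω`. -/
abbrev Eisenstein : Type := QuadraticAlgebra ℤ (-1) (-1)

theorem isPrimitiveRoot_ζ₃ : IsPrimitiveRoot ζ₃ 3 := by
  simpa [ζ₃] using Complex.isPrimitiveRoot_exp 3 (by norm_num)

theorem ζ₃_sq : ζ₃ ^ 2 = -1 - ζ₃ := by
  have h := isPrimitiveRoot_ζ₃.geom_sum_eq_zero (by norm_num)
  simp only [Finset.sum_range_succ, Finset.sum_range_zero] at h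
  linear_combination h

theorem ζ₃_im_ne_zero : ζ₃.im ≠ 0 := by
  intro h
  have h1 := congrArg Complex.re ζ₃_sq
  simp only [pow_two, Complex.mul_re, Complex.sub_re, Complex.neg_re, Complex.one_re, h] at h1
  nlinarith [sq_nonneg (ζ₃.re + 1 / 2)]

/-- The embedding of the Eisenstein integers into `ℂ` that maps `ω` to `ζ₃`. -/
def eisensteinHom : Eisenstein →+* ℂ where
  toFun z := z.re + z.im * ζ₃
  map_zero' := by simp
  map_one' := by simp [QuadraticAlgebra.re_one, QuadraticAlgebra.im_one]
  map_add' z w := by simp; ring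
  map_mul' z w := by
    simp only [QuadraticAlgebra.re_mul, QuadraticAlgebra.im_mul]
    push_cast
    linear_combination (-(z.im : ℂ) * w.im) * ζ₃_sq

theorem eisensteinHom_mk (a b : ℤ) :
    eisensteinHom (⟨a, b⟩ : Eisenstein) = a + b * ζ₃ := rfl

theorem eisensteinHom_injective : Function.Injective eisensteinHom := by
  rw [injective_iff_map_eq_zero]
  rintro ⟨a, b⟩ h
  rw [eisensteinHom_mk] at h
  have him := congrArg Complex.im h
  have hre := congrArg Complex.re h
  simp [ζ₃_im_ne_zero] at him
  subst him
  simp at hre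
  subst hre
  rfl

/-- The additive character `d ↦ ω ^ d` of `𝔽₃` with values in the Eisenstein integers. -/
def rootEis : ZMod 3 → Eisenstein := (![⟨1, 0⟩, ⟨0, 1⟩, ⟨-1, -1⟩] : Fin 3 → Eisenstein)

theorem rootEis_zero : rootEis 0 = 1 := rfl

theorem rootEis_add : ∀ a b : ZMod 3, rootEis (a + b) = rootEis a * rootEis b := by decide +kernel

theorem rootEis_pow_three : ∀ a : ZMod 3, rootEis a ^ 3 = 1 := by decide +kernel

theorem rootEis_injective : Function.Injective rootEis := by decide +kernel

end Eisenstein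

/-! ### The matrices of the decomposition over the Eisenstein integers -/

section IntegralModels

/-- The symplectic form on `𝔽₃²`. -/
def labelForm (x y : Label) : ZMod 3 := x 0 * y 1 - x 1 * y 0

/-- Vectors spanning the column spaces of the first block, for a cube root of unity `z`. -/
def columnTable {R : Type} [CommRing R] (z : R) : Fin 3 → Fin 3 → Fin 3 → R :=
  ![![![1, -1, 0], ![0, 1, -z ^ 2], ![1, 0, -z ^ 2]],
    ![![0, 1, -z], ![1, 0, -1], ![1, -z ^ 2, 0]],
    ![![1, 0, -z], ![1, -z, 0], ![0, 1, -1]]]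

/-- The matrices of the first block, for a cube root of unity `z`. -/
def firstTable {R : Type} [CommRing R] (z : R) : Fin 3 → Fin 3 → Matrix (Fin 3) (Fin 3) R :=
  ![![!![1, -1, 0; -1, 1, 0; 0, 0, 0],
      !![0, 0, 0; 0, 1, -z; 0, -z ^ 2, 1],
      !![1, 0, -z; 0, 0, 0; -z ^ 2, 0, 1]],
    ![!![0, 0, 0; 0, 1, -z ^ 2; 0, -z, 1],
      !![1, 0, -1; 0, 0, 0; -1, 0, 1],
      !![1, -z, 0; -z ^ 2, 1, 0; 0, 0, 0]],
    ![!![1, 0, -z ^ 2; 0, 0, 0; -z, 0, 1],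
      !![1, -z ^ 2, 0; -z, 1, 0; 0, 0, 0],
      !![0, 0, 0; 0, 1, -1; 0, -1, 1]]]

/-- The matrices of the second block, for a cube root of unity `z` and a coefficient `a` of the
scalar matrix. -/
def secondTable {R : Type} [CommRing R] (z a : R) : Fin 3 → Fin 3 → Matrix (Fin 3) (Fin 3) R :=
  ![![!![a, 0, 0; 0, a, 0; 0, 0, a],
      !![0, 1, 0; 0, 0, z; z ^ 2, 0, 0],
      !![0, 0, 1; z ^ 2, 0, 0; 0, z, 0]],
    ![!![0, 1, 0; 0, 0, z ^ 2; z, 0, 0],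
      !![0, 0, 1; 1, 0, 0; 0, 1, 0],
      !![1, 0, 0; 0, z, 0; 0, 0, z ^ 2]],
    ![!![0, 0, 1; z, 0, 0; 0, z ^ 2, 0],
      !![1, 0, 0; 0, z ^ 2, 0; 0, 0, z],
      !![0, 1, 0; 0, 0, 1; 1, 0, 0]]]

theorem map_fin_three {α β : Type} (f : α → β) (a b c d e g h k l : α) :
    (!![a, b, c; d, e, g; h, k, l]).map f =
      !![f a, f b, f c; f d, f e, f g; f h, f k, f l] := by
  ext i j
  fin_cases i <;> fin_cases j <;> rfl

theorem map_table_apply {α β : Type} (f : α → β) (A B C D E G H K L : Matrix (Fin 3) (Fin 3) α)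
    (a b : Fin 3) :
    ((![![A, B, C], ![D, E, G], ![H, K, L]] : Fin 3 → Fin 3 → Matrix _ _ α) a b).map f =
      (![![A.map f, B.map f, C.map f], ![D.map f, E.map f, G.map f],
        ![H.map f, K.map f, L.map f]] : Fin 3 → Fin 3 → Matrix _ _ β) a b := by
  fin_cases a <;> fin_cases b <;> rfl

theorem firstTable_map {R R' : Type} [CommRing R] [CommRing R'] (f : R →+* R') (z : R)
    (a b : Fin 3) : (firstTable z a b).map f = firstTable (f z) a b := by
  rw [firstTable, firstTable, map_table_apply]
  simp only [map_fin_three, map_neg, map_pow, map_one, map_zero]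

theorem secondTable_map {R R' : Type} [CommRing R] [CommRing R'] (f : R →+* R') (z c : R)
    (a b : Fin 3) : (secondTable z c a b).map f = secondTable (f z) (f c) a b := by
  rw [secondTable, secondTable, map_table_apply]
  simp only [map_fin_three, map_pow, map_one, map_zero]

theorem table_congr {α : Type} (A A' B C D E G H K L : α) (a b : Fin 3)
    (h : ¬(a = 0 ∧ b = 0)) :
    (![![A, B, C], ![D, E, G], ![H, K, L]] : Fin 3 → Fin 3 → α) a b =
      (![![A', B, C], ![D, E, G], ![H, K, L]] : Fin 3 → Fin 3 → α) a b := by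
  fin_cases a <;> fin_cases b <;> first | exact absurd ⟨rfl, rfl⟩ h | rfl

/-- The coefficient a, which is not an Eisenstein integer, occurs only at the label 0. At all other
labels it may be replaced by 1, so the integral model applies there. -/
theorem secondTable_congr {R : Type} [CommRing R] (z c c' : R) (a b : Fin 3)
    (h : ¬(a = 0 ∧ b = 0)) : secondTable z c a b = secondTable z c' a b :=
  table_congr _ _ _ _ _ _ _ _ _ _ a b h

/-- The generator `ω` of the Eisenstein integers. -/
def omegaEis : Eisenstein := ⟨0, 1⟩

theorem eisensteinHom_omegaEis : eisensteinHom omegaEis = ζ₃ := by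
  simp [omegaEis, eisensteinHom_mk]

/-- Vectors spanning the column spaces of the first block. -/
def columnEis (x : Label) : Fin 3 → Eisenstein := columnTable omegaEis (x 0) (x 1)

/-- Vectors spanning the row spaces of the first block. -/
def rowEis (x : Label) : Fin 3 → Eisenstein := columnEis (swapLabel x)

/-- The matrices of the first block over the Eisenstein integers. -/
def firstEis (x : Label) : Matrix (Fin 3) (Fin 3) Eisenstein :=
  firstTable omegaEis (x 0) (x 1)

/-- The matrices of the second block over the Eisenstein integers, up to the normalization of the
scalar matrix. -/
def secondEis (x : Label) : Matrix (Fin 3) (Fin 3) Eisenstein :=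
  secondTable omegaEis 1 (x 0) (x 1)

theorem label_eq (x : Label) : x = ![x 0, x 1] := by
  ext i
  fin_cases i <;> rfl

/-- Replaces quantification over functions by nested quantification over `ZMod 3`, the form in which
the finite checks are evaluated. -/
theorem forall_label {p : Label → Prop} : (∀ x, p x) ↔ ∀ a b : ZMod 3, p ![a, b] :=
  ⟨fun h _ _ => h _, fun h x => label_eq x ▸ h _ _⟩

theorem firstBlock_eq_map (x : Label) : firstBlock x = (firstEis x).map eisensteinHom := by
  have h := firstTable_map eisensteinHom omegaEis (x 0) (x 1)
  rw [eisensteinHom_omegaEis] at h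
  exact h.symm

theorem secondBlock_zero : secondBlock 0 = aCoeff • (1 : Mat 3) := by
  change (!![aCoeff, 0, 0; 0, aCoeff, 0; 0, 0, aCoeff] : Mat 3) = _
  rw [Matrix.one_fin_three]
  simp

theorem secondBlock_eq_map (x : Label) (hx : x ≠ 0) :
    secondBlock x = (secondEis x).map eisensteinHom := by
  have h := secondTable_map eisensteinHom omegaEis 1 (x 0) (x 1)
  rw [eisensteinHom_omegaEis] at h
  refine Eq.trans (secondTable_congr ζ₃ aCoeff _ (x 0) (x 1) fun h => hx ?_) h.symm
  rw [label_eq x]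
  ext i
  fin_cases i
  exacts [h.1, h.2]

/-- The rank-one factorization turns traces of products into cyclic products of the scalars
`gramEis`. The row vector is the column vector of the swapped label because transposition swaps the
label. -/
theorem firstEis_eq_vecMulVec : ∀ x, firstEis x = vecMulVec (columnEis x) (rowEis x) := by
  simp only [forall_label]
  decide +kernel

/-- The scalar products of the row and column vectors of the first block. -/
def gramEis (x y : Label) : Eisenstein :=
  rowEis x 0 * columnEis y 0 + rowEis x 1 * columnEis y 1 + rowEis x 2 * columnEis y 2

theorem trace_firstEis_eq_gramEis (x : Label) : (firstEis x).trace = gramEis x x := by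
  simp only [Matrix.trace_fin_three, firstEis_eq_vecMulVec, vecMulVec_apply, gramEis]
  ring

theorem trace_firstEis_mul_eq_gramEis (x y : Label) :
    (firstEis x * firstEis y).trace = gramEis x y * gramEis y x := by
  simp only [Matrix.trace_fin_three, firstEis_eq_vecMulVec, vecMulVec_apply, gramEis,
    Matrix.mul_apply, Fin.sum_univ_three]
  ring

theorem trace_firstEis_mul_mul_eq_gramEis (x y z : Label) :
    (firstEis x * firstEis y * firstEis z).trace = gramEis x y * gramEis y z * gramEis z x := by
  simp only [Matrix.trace_fin_three, firstEis_eq_vecMulVec, vecMulVec_apply, gramEis,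
    Matrix.mul_apply, Fin.sum_univ_three]
  ring

theorem gramEis_self : ∀ x, gramEis x x = 2 := by
  simp only [forall_label]
  decide +kernel

/-- Equiangularity: pairs of labels carry no information beyond equality, so the whole geometry sits
in the triple products. -/
theorem gramEis_mul_gramEis : ∀ x y, x ≠ y → gramEis x y * gramEis y x = 1 := by
  simp only [forall_label]
  decide +kernel

theorem gramEis_mul_mul : ∀ x y z : Label, x ≠ y → y ≠ z → z ≠ x →
    gramEis x y * gramEis y z * gramEis z x = -rootEis (-labelForm (y - x) (z - x)) := by
  simp only [forall_label]
  decide +kernel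

theorem firstEis_transpose : ∀ x, (firstEis x)ᵀ = firstEis (swapLabel x) := by
  simp only [forall_label]
  decide +kernel

theorem sum_firstEis : ∑ y, firstEis y = 6 • 1 := by
  decide +kernel

/-- Fourier inversion: the second block consists, up to scalars, of the Fourier coefficients of the
first block. -/
theorem exists_sum_rootEis_smul_firstEis : ∀ x : Label, x ≠ 0 →
    ∃ j : ZMod 3, ∑ y, rootEis (labelForm x y) • firstEis y = (-3 * rootEis j) • secondEis x := by
  simp only [forall_label]
  decide +kernel

/-- On a line of labels the coefficients of the linear dependence can be taken to be sixth roots of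
unity, ±ω^k. The existential then ranges over a finite set and can be decided. -/
theorem exists_columnEis_eq : ∀ x y : Label, x ≠ y → ∃ a b : ZMod 3, ∃ s t : ZMod 2,
    columnEis (-(x + y)) = ((-1) ^ s.val * rootEis a) • columnEis x +
      ((-1) ^ t.val * rootEis b) • columnEis y := by
  simp only [forall_label]
  decide +kernel

theorem det_columnEis_ne_zero : ∀ x y z : Label, x ≠ y → x ≠ z → y ≠ z → x + y + z ≠ 0 →
    (of ![columnEis x, columnEis y, columnEis z]).det ≠ 0 := by
  simp only [forall_label, Matrix.det_fin_three]
  decide +kernel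

/-- Conjugation by the Weyl operators translates the labels of the first block. -/
theorem secondEis_mul_firstEis : ∀ v : Label, (secondEis (-v)).det ≠ 0 ∧
    ∀ x, secondEis (-v) * firstEis x = firstEis (x + v) * secondEis (-v) := by
  simp only [forall_label, Matrix.det_fin_three]
  decide +kernel

/-- The operator that shears the labels of the first block and commutes with the Weyl operator
`w`. -/
def shearEis (w : Matrix (Fin 3) (Fin 3) Eisenstein) : Matrix (Fin 3) (Fin 3) Eisenstein :=
  (-1 - omegaEis) • 1 + w + w * w

/-- Here w³ = 1, and `shearEis w` has the values 1 - ω, ω² - 1, ω² - 1 on the eigenvectors of w for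
1, ω, ω². Their ratios 1 : ω² : ω² are a quadratic phase, so the operator normalizes the Weyl group;
as it commutes with w, it fixes the direction of w and shears the others. -/
theorem shearEis_lower : (shearEis (secondEis ![0, 1])).det ≠ 0 ∧
    ∀ x, shearEis (secondEis ![0, 1]) * firstEis x =
      firstEis ![x 0, x 0 + x 1] * shearEis (secondEis ![0, 1]) := by
  simp only [forall_label, Matrix.det_fin_three]
  decide +kernel

theorem shearEis_upper : (shearEis (secondEis ![1, 0])).det ≠ 0 ∧
    ∀ x, shearEis (secondEis ![1, 0]) * firstEis x =
      firstEis ![x 0 - x 1, x 1] * shearEis (secondEis ![1, 0]) := by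
  simp only [forall_label, Matrix.det_fin_three]
  decide +kernel

end IntegralModels

/-! ### Symmetric tensors and the trace pairing -/

section TracePairing

theorem trace_mul_single_one {n : ℕ} (X : Mat n) (i j : Fin n) :
    (X * Matrix.single j i 1).trace = X i j := by
  rw [Matrix.trace_mul_comm, Matrix.trace_single_mul]
  simp

theorem eq_of_trace_mul_eq {n : ℕ} {X Y : Mat n} (h : ∀ A, (X * A).trace = (Y * A).trace) :
    X = Y := by
  ext i j
  have := h (Matrix.single j i 1)
  rwa [trace_mul_single_one, trace_mul_single_one] at this

theorem exists_trace_mul_ne_zero {n : ℕ} {X : Mat n} (h : X ≠ 0) : ∃ A, (X * A).trace ≠ 0 := by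
  by_contra! hc
  exact h (eq_of_trace_mul_eq fun A => by rw [hc A, zero_mul, Matrix.trace_zero])

/-- A tensor is determined by the trilinear form to which it corresponds by the trace pairing. -/
theorem eq_of_traceEval_eq {n : ℕ} {s t : ⨂[ℂ] _ : Fin 3, Mat n}
    (h : ∀ A, traceEval n A s = traceEval n A t) : s = t := by
  let b := Matrix.stdBasis ℂ (Fin n) (Fin n)
  let B := Basis.piTensorProduct (R := ℂ) (fun _ : Fin 3 => b)
  refine B.ext_elem fun p => ?_
  -- Coordinates in the product basis are trace evaluations at transposed matrix units, since tr (X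
  -- E_ji) = X_ij.
  have key : B.coord p = traceEval n (fun i => Matrix.single (p i).2 (p i).1 1) := by
    apply PiTensorProduct.ext
    apply MultilinearMap.ext
    intro X
    change B.repr (PiTensorProduct.tprod ℂ X) p = traceEval n _ (PiTensorProduct.tprod ℂ X)
    rw [traceEval_tprod, Basis.piTensorProduct_repr_tprod_apply]
    refine Finset.prod_congr rfl fun i _ => ?_
    rw [trace_mul_single_one]
    simp [b, Matrix.stdBasis, Pi.basis_repr]
  change B.coord p s = B.coord p t
  rw [key, h]

theorem traceEval_cube {n : ℕ} (w A B C : Mat n) :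
    traceEval n ![A, B, C] (cube w).1 = (w * A).trace * (w * B).trace * (w * C).trace := by
  simp only [cube, traceEval_tprod, Fin.prod_univ_three, Matrix.cons_val]

theorem cube_smul {n : ℕ} (c : ℂ) (w : Mat n) : cube (c • w) = c ^ 3 • cube w := by
  apply Subtype.ext
  change PiTensorProduct.tprod ℂ (fun _ : Fin 3 => c • w) =
    c ^ 3 • PiTensorProduct.tprod ℂ (fun _ : Fin 3 => w)
  rw [MultilinearMap.map_smul_univ _ (fun _ => c)]
  simp

/-- Two elements with the same cube differ by a cube root of unity. -/
theorem exists_eq_smul_of_cube_eq {n : ℕ} {w w' : Mat n} (h : cube w = cube w') (hw' : w' ≠ 0) :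
    ∃ c : ℂ, c ^ 3 = 1 ∧ w = c • w' := by
  obtain ⟨A, hA⟩ := exists_trace_mul_ne_zero hw'
  have key : ∀ B C D, (w * B).trace * (w * C).trace * (w * D).trace =
      (w' * B).trace * (w' * C).trace * (w' * D).trace := by
    intro B C D
    rw [← traceEval_cube, h, traceEval_cube]
  have hA' : (w * A).trace ≠ 0 := by
    intro h0
    have := key A A A
    rw [h0] at this
    simp [hA] at this
  -- Evaluation at A, A, B gives tr(wA)² tr(wB) = tr(w'A)² tr(w'B) for every B, which dictates this
  -- scalar; evaluation at A, A, A shows that its cube is 1.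
  refine ⟨((w' * A).trace / (w * A).trace) ^ 2, ?_, ?_⟩
  · have := key A A A
    field_simp
    linear_combination (-((w * A).trace ^ 3 + (w' * A).trace ^ 3)) * this
  · refine eq_of_trace_mul_eq fun B => ?_
    have := key A A B
    rw [Matrix.smul_mul, Matrix.trace_smul, smul_eq_mul]
    field_simp
    linear_combination this

theorem cubeAction_eq_of_eq_smul {W : Type} [AddCommGroup W] [Module ℂ W] {g h : W ≃ₗ[ℂ] W}
    {c : ℂ} (hc : c ^ 3 = 1) (hgh : ∀ w, g w = c • h w) : cubeAction W g = cubeAction W h := by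
  have key : PiTensorProduct.map (fun _ : Fin 3 => (g : W →ₗ[ℂ] W)) =
      PiTensorProduct.map (fun _ : Fin 3 => (h : W →ₗ[ℂ] W)) := by
    apply PiTensorProduct.ext
    apply MultilinearMap.ext
    intro X
    have e : (fun i => g (X i)) = fun i => c • h (X i) := funext fun i => hgh _
    calc PiTensorProduct.map (fun _ : Fin 3 => (g : W →ₗ[ℂ] W)) (PiTensorProduct.tprod ℂ X)
        = PiTensorProduct.tprod ℂ (fun i => g (X i)) := PiTensorProduct.map_tprod _ _
      _ = PiTensorProduct.tprod ℂ (fun i => h (X i)) := by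
        rw [e, MultilinearMap.map_smul_univ _ (fun _ => c)]
        simp [hc]
      _ = _ := (PiTensorProduct.map_tprod _ _).symm
  apply LinearEquiv.ext
  intro t
  exact Subtype.ext (congrArg (fun f => f t.1) key)

/-- The adjoint of a linear map with respect to the trace pairing. -/
theorem exists_trace_adjoint {n : ℕ} (g : Mat n ≃ₗ[ℂ] Mat n) :
    ∃ φ : Mat n →ₗ[ℂ] Mat n, ∀ X A, (g X * A).trace = (X * φ A).trace := by
  refine ⟨{ toFun := fun A => of fun j i => (g (Matrix.single i j 1) * A).trace
            map_add' := fun A B => by ext; simp [mul_add]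
            map_smul' := fun c A => by ext; simp }, fun X A => ?_⟩
  conv_lhs => rw [Matrix.matrix_eq_sum_single X]
  have h : ∀ i j, Matrix.single i j (X i j) = X i j • (Matrix.single i j 1 : Mat n) := by
    intro i j
    rw [Matrix.smul_single, smul_eq_mul, mul_one]
  simp only [h, map_sum, map_smul, Finset.sum_mul, Matrix.trace_sum, Matrix.smul_mul,
    Matrix.trace_smul, smul_eq_mul]
  rfl

theorem traceEval_cubeAction {n : ℕ} {g : Mat n ≃ₗ[ℂ] Mat n} {φ : Mat n → Mat n}
    (h : ∀ X A, (g X * A).trace = (X * φ A).trace) (A : Fin 3 → Mat n) (t : Sym3 (Mat n)) :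
    traceEval n A (cubeAction (Mat n) g t).1 = traceEval n (fun i => φ (A i)) t.1 := by
  have key : (traceEval n A).comp (PiTensorProduct.map (fun _ => (g : Mat n →ₗ[ℂ] Mat n))) =
      traceEval n (fun i => φ (A i)) := by
    apply PiTensorProduct.ext
    apply MultilinearMap.ext
    intro X
    simp only [LinearMap.compMultilinearMap_apply, LinearMap.comp_apply, PiTensorProduct.map_tprod,
      traceEval_tprod]
    exact Finset.prod_congr rfl fun i _ => h _ _
  exact congrArg (fun f => f t.1) key

/-- The symmetric trilinear form that corresponds to `2 sM_⟨n⟩`. -/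
def symTrace {n : ℕ} (A B C : Mat n) : ℂ := (A * B * C).trace + (A * C * B).trace

theorem traceEval_sM_eq {n : ℕ} (A : Fin 3 → Mat n) :
    traceEval n A (sM n).1 = 1 / 2 * symTrace (A 0) (A 1) (A 2) := by
  have : A = ![A 0, A 1, A 2] := by
    ext i : 1
    fin_cases i <;> rfl
  rw [this]
  exact traceEval_sM _ _ _

/-- The form is a function on the dual space, so g acts on it through its trace adjoint φ. -/
theorem cubeAction_sM_iff {n : ℕ} {g : Mat n ≃ₗ[ℂ] Mat n} {φ : Mat n → Mat n}
    (h : ∀ X A, (g X * A).trace = (X * φ A).trace) :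
    cubeAction (Mat n) g (sM n) = sM n ↔
      ∀ A B C, symTrace (φ A) (φ B) (φ C) = symTrace A B C := by
  constructor
  · intro hg A B C
    have h1 := traceEval_cubeAction h ![A, B, C] (sM n)
    rw [hg, traceEval_sM_eq, traceEval_sM_eq] at h1
    simp only [Matrix.cons_val] at h1
    linear_combination (-2) * h1
  · intro hf
    refine Subtype.ext (eq_of_traceEval_eq fun A => ?_)
    rw [traceEval_cubeAction h, traceEval_sM_eq, traceEval_sM_eq, hf]

end TracePairing

/-! ### Linear maps that fix the symmetrized matrix multiplication tensor -/

section Stabilizer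

theorem trace_eq_zero_of_mul_self {X : Mat 3} (h : X * X = 0) : X.trace = 0 := by
  have : IsNilpotent X := ⟨2, by rw [pow_two, h]⟩
  exact (Matrix.isNilpotent_trace_of_isNilpotent this).eq_zero

/-- Square-zero matrices span the traceless ones, whose orthogonal complement for the trace form is
the scalars. Off-diagonal matrix units kill the off-diagonal entries of Y; the two explicit
matrices, with diagonals (1, -1, 0) and (0, 1, -1), equate its diagonal entries. -/
theorem eq_smul_one_of_trace_mul_eq_zero {Y : Mat 3}
    (h : ∀ X, X * X = 0 → (Y * X).trace = 0) : Y = Y 0 0 • (1 : Mat 3) := by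
  have hoff : ∀ i j, i ≠ j → Y i j = 0 := by
    intro i j hij
    have := h (Matrix.single j i 1) (by rw [Matrix.single_mul_single_of_ne _ _ _ _ hij])
    rwa [trace_mul_single_one] at this
  have h1 := h !![1, -1, 0; 1, -1, 0; 0, 0, 0] (by
    ext i j; fin_cases i <;> fin_cases j <;> simp [Matrix.mul_apply, Fin.sum_univ_three])
  have h2 := h !![0, 0, 0; 0, 1, -1; 0, 1, -1] (by
    ext i j; fin_cases i <;> fin_cases j <;> simp [Matrix.mul_apply, Fin.sum_univ_three])
  simp [Matrix.trace_fin_three, Matrix.mul_apply, Fin.sum_univ_three, hoff] at h1 h2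
  ext i j
  by_cases hij : i = j
  · subst hij
    fin_cases i
    · simp
    · simp
      linear_combination -h1
    · simp
      linear_combination -h1 - h2
  · simp [hoff i j hij, hij]

/-- (1 - N)/2 is idempotent of trace 0, and in characteristic zero the trace of an idempotent is its
rank. -/
theorem eq_one_of_mul_self_eq_one {N : Mat 3} (h : N * N = 1) (ht : N.trace = 3) : N = 1 := by
  have hE : IsIdempotentElem ((1 / 2 : ℂ) • (1 - N)) := by
    change ((1 / 2 : ℂ) • (1 - N)) * ((1 / 2 : ℂ) • (1 - N)) = (1 / 2 : ℂ) • (1 - N)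
    rw [smul_mul_smul_comm, sub_mul, mul_sub, mul_sub, h, one_mul, one_mul, mul_one]
    module
  have hE' : IsIdempotentElem (Matrix.toLin' ((1 / 2 : ℂ) • (1 - N))) := by
    change Matrix.toLin' _ ∘ₗ Matrix.toLin' _ = _
    rw [← Matrix.toLin'_mul, hE.eq]
  have h0 := LinearMap.IsIdempotentElem.eq_zero_of_trace_eq_zero hE' (by
    rw [Matrix.trace_toLin'_eq, Matrix.trace_smul, Matrix.trace_sub, ht]
    simp)
  rw [LinearEquiv.map_eq_zero_iff, smul_eq_zero_iff_right (by norm_num), sub_eq_zero] at h0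
  exact h0.symm

variable {g : Mat 3 ≃ₗ[ℂ] Mat 3}

/-- With two equal arguments the form is 2 tr(X²C). Nondegeneracy of the trace form then converts
invariance of the form into a statement about squares. -/
theorem map_mul_self_of_symTrace {φ : Mat 3 → Mat 3}
    (h : ∀ X A, (g X * A).trace = (X * φ A).trace)
    (hf : ∀ A B C, symTrace (φ A) (φ B) (φ C) = symTrace A B C) (X : Mat 3) :
    g (φ X * φ X) = X * X := by
  refine eq_of_trace_mul_eq fun C => ?_
  rw [h]
  have h1 := hf X X C
  have h2 : ∀ X C : Mat 3, symTrace X X C = 2 * (X * X * C).trace := by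
    intro X C
    rw [symTrace, Matrix.trace_mul_cycle X C X]
    ring
  rw [h2, h2] at h1
  exact mul_left_cancel₀ two_ne_zero h1

/-- A linear map that fixes `sM_⟨3⟩` preserves the line of scalar matrices. -/
theorem exists_map_one_eq_smul (hg : cubeAction (Mat 3) g (sM 3) = sM 3) :
    ∃ c : ℂ, g 1 = c • (1 : Mat 3) := by
  obtain ⟨φ, hφ⟩ := exists_trace_adjoint g
  have hf := (cubeAction_sM_iff hφ).1 hg
  -- For X² = 0 the pairing tr(g(1) X) equals tr φ(X), and φ(X) is again square-zero because
  -- g(φ(X)²) = X² = 0.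
  refine ⟨_, eq_smul_one_of_trace_mul_eq_zero fun X hX => ?_⟩
  rw [hφ, one_mul]
  refine trace_eq_zero_of_mul_self ?_
  rw [← LinearEquiv.map_eq_zero_iff g, map_mul_self_of_symTrace hφ hf, hX]

/-- A linear map that fixes `sM_⟨3⟩` and the unit matrix is orthogonal for the trace form. -/
theorem trace_map_mul_map (hg : cubeAction (Mat 3) g (sM 3) = sM 3) (h1 : g 1 = 1)
    (X Y : Mat 3) : (g X * g Y).trace = (X * Y).trace := by
  obtain ⟨φ, hφ⟩ := exists_trace_adjoint g
  have hsq := map_mul_self_of_symTrace hφ ((cubeAction_sM_iff hφ).1 hg)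
  have hφ1 : φ 1 = 1 := by
    refine eq_one_of_mul_self_eq_one (g.injective ?_) ?_
    · rw [hsq, h1, mul_one]
    · have := hφ 1 1
      rw [h1, one_mul, one_mul] at this
      rw [← this]
      simp
  -- Polarization: the part of the square identity at X + 1 that is linear in X reads 2 g(φ X) = 2
  -- X, so the adjoint of g is its inverse.
  have hinv : ∀ X, g (φ X) = X := by
    intro X
    have h2 := hsq (X + 1)
    rw [map_add, hφ1] at h2
    simp only [add_mul, mul_add, one_mul, mul_one, map_add, hsq, h1] at h2
    have h3 : (2 : ℂ) • g (φ X) = (2 : ℂ) • X := by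
      rw [← sub_eq_zero] at h2 ⊢
      rw [← h2]
      module
    exact smul_right_injective _ (two_ne_zero (α := ℂ)) h3
  rw [hφ]
  congr 2
  exact g.injective (hinv _)

theorem trace_map (hg : cubeAction (Mat 3) g (sM 3) = sM 3) (h1 : g 1 = 1) (X : Mat 3) :
    (g X).trace = X.trace := by
  have := trace_map_mul_map hg h1 X 1
  rwa [h1, mul_one, mul_one] at this

/-- A linear map that is orthogonal for the trace form fixes `sM_⟨3⟩` if and only if it preserves
the corresponding trilinear form. -/
theorem cubeAction_sM_iff_of_orthogonal (hg : ∀ X Y, (g X * g Y).trace = (X * Y).trace) :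
    cubeAction (Mat 3) g (sM 3) = sM 3 ↔
      ∀ A B C, symTrace (g A) (g B) (g C) = symTrace A B C := by
  rw [cubeAction_sM_iff (φ := g.symm) fun X A => by rw [← hg X, g.apply_symm_apply]]
  constructor
  · intro h A B C
    have := h (g A) (g B) (g C)
    simpa using this.symm
  · intro h A B C
    have := h (g.symm A) (g.symm B) (g.symm C)
    simpa using this.symm

end Stabilizer

/-! ### The first block as a basis -/

section FirstBlock

/-- The Bargmann invariants `tr (P_x P_y P_z)` of the first block. -/
def tripleGram (x y z : Label) : Eisenstein := gramEis x y * gramEis y z * gramEis z x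

theorem trace_map_eisensteinHom (A : Matrix (Fin 3) (Fin 3) Eisenstein) :
    (A.map eisensteinHom).trace = eisensteinHom A.trace :=
  (AddMonoidHom.map_trace eisensteinHom A).symm

theorem trace_firstBlock (x : Label) : (firstBlock x).trace = 2 := by
  rw [firstBlock_eq_map, trace_map_eisensteinHom, trace_firstEis_eq_gramEis, gramEis_self, map_ofNat]

theorem gramEis_mul_gramEis_eq_ite (x y : Label) :
    gramEis x y * gramEis y x = if x = y then 4 else 1 := by
  split_ifs with h
  · subst h
    rw [gramEis_self]
    norm_num
  · exact gramEis_mul_gramEis x y h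

theorem trace_firstBlock_mul (x y : Label) :
    (firstBlock x * firstBlock y).trace = if x = y then 4 else 1 := by
  rw [firstBlock_eq_map, firstBlock_eq_map, ← Matrix.map_mul, trace_map_eisensteinHom,
    trace_firstEis_mul_eq_gramEis, gramEis_mul_gramEis_eq_ite]
  split_ifs
  · rw [map_ofNat]
  · rw [map_one]

theorem trace_firstBlock_mul_mul (x y z : Label) :
    (firstBlock x * firstBlock y * firstBlock z).trace = eisensteinHom (tripleGram x y z) := by
  rw [firstBlock_eq_map, firstBlock_eq_map, firstBlock_eq_map, ← Matrix.map_mul, ← Matrix.map_mul,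
    trace_map_eisensteinHom, trace_firstEis_mul_mul_eq_gramEis]
  rfl

theorem symTrace_firstBlock (x y z : Label) :
    symTrace (firstBlock x) (firstBlock y) (firstBlock z) =
      eisensteinHom (tripleGram x y z + tripleGram x z y) := by
  rw [symTrace, trace_firstBlock_mul_mul, trace_firstBlock_mul_mul, map_add]

theorem labelForm_swap (x y z : Label) :
    labelForm (z - x) (y - x) = -labelForm (y - x) (z - x) := by
  simp only [labelForm]
  ring

/-- The Bargmann invariants are invariant under symplectic affine transformations. -/
theorem tripleGram_comp {π : Label → Label} (hπ : Function.Injective π)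
    (hform : ∀ x y z, labelForm (π y - π x) (π z - π x) = labelForm (y - x) (z - x))
    (x y z : Label) : tripleGram (π x) (π y) (π z) = tripleGram x y z := by
  have hpair : ∀ x y, gramEis (π x) (π y) * gramEis (π y) (π x) = gramEis x y * gramEis y x := by
    intro x y
    simp only [gramEis_mul_gramEis_eq_ite, hπ.eq_iff]
  simp only [tripleGram]
  -- If two labels coincide, the triple product reduces to a diagonal value times a pair product;
  -- only distinct labels involve the area.
  by_cases hxy : x = y
  · subst hxy
    simp only [mul_assoc, gramEis_self, hpair]
  by_cases hyz : y = z
  · subst hyz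
    rw [mul_right_comm, mul_right_comm (gramEis x y), hpair, gramEis_self, gramEis_self]
  by_cases hzx : z = x
  · subst hzx
    simp only [gramEis_self, hpair]
  rw [gramEis_mul_mul _ _ _ hxy hyz hzx, gramEis_mul_mul _ _ _ (hπ.ne hxy) (hπ.ne hyz) (hπ.ne hzx),
    hform]

/-- The unsymmetrized triple product determines the area with its sign, because d ↦ ω^d is injective
on 𝔽₃. This separates conjugations from transposition. -/
theorem labelForm_eq_of_tripleGram_eq {x y z x' y' z' : Label} (hxy : x ≠ y) (hyz : y ≠ z)
    (hzx : z ≠ x) (hxy' : x' ≠ y') (hyz' : y' ≠ z') (hzx' : z' ≠ x')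
    (h : tripleGram x' y' z' = tripleGram x y z) :
    labelForm (y' - x') (z' - x') = labelForm (y - x) (z - x) := by
  rw [tripleGram, tripleGram, gramEis_mul_mul _ _ _ hxy hyz hzx,
    gramEis_mul_mul _ _ _ hxy' hyz' hzx'] at h
  exact neg_injective (rootEis_injective (neg_injective h))

/-- The sum is -2 at d = 0 and 1 otherwise: symmetrization forgets the sign of the area but still
detects collinearity. -/
theorem rootEis_neg_add_rootEis_eq : ∀ d : ZMod 3,
    -rootEis (-d) + -rootEis d = -2 ↔ d = 0 := by
  decide +kernel

theorem labelForm_eq_zero_iff : ∀ u w : Label, u ≠ 0 → w ≠ 0 → u ≠ w →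
    (labelForm u w = 0 ↔ u + w = 0) := by
  simp only [forall_label]
  decide +kernel

theorem three_nsmul_label (x : Label) : x + x + x = 0 := by
  ext i
  have h : ∀ a : ZMod 3, a + a + a = 0 := by decide
  exact h (x i)

theorem labelForm_sub_eq_zero_iff (x y z : Label) (hxy : x ≠ y) (hyz : y ≠ z) (hzx : z ≠ x) :
    labelForm (y - x) (z - x) = 0 ↔ x + y + z = 0 := by
  rw [labelForm_eq_zero_iff _ _ (sub_ne_zero.2 hxy.symm) (sub_ne_zero.2 hzx)
    (fun h => hyz (sub_left_injective h))]
  have : y - x + (z - x) = x + y + z := by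
    rw [← sub_eq_zero, ← neg_eq_zero, ← three_nsmul_label x]
    abel
  rw [this]

/-- Collinearity of labels is expressed by the trilinear form. -/
theorem tripleGram_add_eq_iff {x y z : Label} (hxy : x ≠ y) (hyz : y ≠ z) (hzx : z ≠ x) :
    tripleGram x y z + tripleGram x z y = -2 ↔ x + y + z = 0 := by
  rw [tripleGram, tripleGram, gramEis_mul_mul _ _ _ hxy hyz hzx,
    gramEis_mul_mul _ _ _ hzx.symm hyz.symm hxy.symm, labelForm_swap x y z, neg_neg,
    rootEis_neg_add_rootEis_eq, labelForm_sub_eq_zero_iff x y z hxy hyz hzx]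

theorem card_label : Fintype.card Label = 9 := by simp [ZMod.card]

/-- The Gram matrix for the trace form is 3I + J, with J the all-ones matrix. A relation gives 3 c_y
= -s with s the sum of the coefficients; summing over the nine labels gives 12 s = 0. -/
theorem linearIndependent_firstBlock : LinearIndependent ℂ firstBlock := by
  rw [Fintype.linearIndependent_iff]
  intro c hc
  have h : ∀ y, 3 * c y = -∑ x, c x := by
    intro y
    have h1 := congrArg (fun X => (X * firstBlock y).trace) hc
    have h2 : ∀ x, c x * (if x = y then (4 : ℂ) else 1) = c x + (if x = y then 3 * c x else 0) := by
      intro x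
      split_ifs <;> ring
    simp only [Finset.sum_mul, Matrix.trace_sum, Matrix.smul_mul, Matrix.trace_smul, smul_eq_mul,
      trace_firstBlock_mul, h2, zero_mul, Matrix.trace_zero, Finset.sum_add_distrib,
      Finset.sum_ite_eq', Finset.mem_univ, if_true] at h1
    linear_combination h1
  have hs : ∑ x, c x = 0 := by
    have h1 : ∑ y, 3 * c y = ∑ _y : Label, -∑ x, c x := Finset.sum_congr rfl fun y _ => h y
    rw [← Finset.mul_sum, Finset.sum_const, Finset.card_univ, card_label, nsmul_eq_mul] at h1
    push_cast at h1
    linear_combination h1 / 12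
  intro y
  have := h y
  rw [hs] at this
  simpa using this

/-- The first block is a basis of the space of matrices. -/
def firstBasis : Module.Basis Label ℂ (Mat 3) :=
  basisOfLinearIndependentOfCardEqFinrank linearIndependent_firstBlock (by
    rw [card_label, Module.finrank_matrix]
    simp)

theorem firstBasis_apply (x : Label) : firstBasis x = firstBlock x := by
  simp [firstBasis]

theorem firstBlock_induction {p : Mat 3 → Prop} (h : ∀ x, p (firstBlock x))
    (hadd : ∀ X Y, p X → p Y → p (X + Y)) (hsmul : ∀ (c : ℂ) X, p X → p (c • X)) (X : Mat 3) :
    p X := by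
  have hX : X ∈ Submodule.span ℂ (Set.range firstBasis) := by
    rw [firstBasis.span_eq]
    trivial
  induction hX using Submodule.span_induction with
  | mem _ hx =>
    obtain ⟨x, rfl⟩ := hx
    rw [firstBasis_apply]
    exact h x
  | zero => simpa using hsmul 0 _ (h 0)
  | add _ _ _ _ h1 h2 => exact hadd _ _ h1 h2
  | smul c _ _ h1 => exact hsmul c _ h1

/-- The linear maps that permute the first block. -/
def permRep : Equiv.Perm Label →* (Mat 3 ≃ₗ[ℂ] Mat 3) where
  toFun π := firstBasis.equiv firstBasis π
  map_one' := firstBasis.equiv_refl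
  map_mul' π σ := firstBasis.ext' fun x => by
    rw [Module.Basis.equiv_apply, LinearEquiv.mul_apply, Module.Basis.equiv_apply,
      Module.Basis.equiv_apply]
    rfl

theorem permRep_firstBlock (π : Equiv.Perm Label) (x : Label) :
    permRep π (firstBlock x) = firstBlock (π x) := by
  rw [← firstBasis_apply, ← firstBasis_apply]
  exact firstBasis.equiv_apply _ _ _

theorem eq_permRep {g : Mat 3 ≃ₗ[ℂ] Mat 3} {π : Equiv.Perm Label}
    (h : ∀ x, g (firstBlock x) = firstBlock (π x)) : g = permRep π := by
  refine firstBasis.ext' fun x => ?_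
  rw [firstBasis_apply, h, permRep_firstBlock]

/-- Every permutation is orthogonal, since the Gram matrix has one value on the diagonal and one off
it. -/
theorem trace_permRep_mul (π : Equiv.Perm Label) (X Y : Mat 3) :
    (permRep π X * permRep π Y).trace = (X * Y).trace := by
  induction X using firstBlock_induction with
  | hadd X X' h h' => simp only [map_add, add_mul, Matrix.trace_add, h, h']
  | hsmul c X h => simp only [map_smul, Matrix.smul_mul, Matrix.trace_smul, h]
  | h x =>
    induction Y using firstBlock_induction with
    | hadd X X' h h' => simp only [map_add, mul_add, Matrix.trace_add, h, h']
    | hsmul c X h => simp only [map_smul, Matrix.mul_smul, Matrix.trace_smul, h]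
    | h y => simp only [permRep_firstBlock, trace_firstBlock_mul, π.injective.eq_iff]

theorem symTrace_add_left (A A' B C : Mat 3) :
    symTrace (A + A') B C = symTrace A B C + symTrace A' B C := by
  simp only [symTrace, add_mul, Matrix.trace_add]
  ring

theorem symTrace_smul_left (c : ℂ) (A B C : Mat 3) :
    symTrace (c • A) B C = c * symTrace A B C := by
  simp only [symTrace, Matrix.smul_mul, Matrix.trace_smul, smul_eq_mul]
  ring

theorem symTrace_rotate (A B C : Mat 3) : symTrace A B C = symTrace B C A := by
  rw [symTrace, symTrace, Matrix.trace_mul_cycle A B C, Matrix.trace_mul_cycle A C B,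
    Matrix.trace_mul_cycle C A B]

theorem symTrace_permRep {π : Equiv.Perm Label}
    (h : ∀ x y z, tripleGram (π x) (π y) (π z) + tripleGram (π x) (π z) (π y) =
      tripleGram x y z + tripleGram x z y) (A B C : Mat 3) :
    symTrace (permRep π A) (permRep π B) (permRep π C) = symTrace A B C := by
  induction A using firstBlock_induction with
  | hadd X X' h h' => simp only [map_add, symTrace_add_left, h, h']
  | hsmul c X h => simp only [map_smul, symTrace_smul_left, h]
  | h x =>
    -- Cyclic rotation brings the next argument to the first place, so linearity in the first
    -- argument suffices.
    rw [symTrace_rotate, symTrace_rotate (firstBlock x)]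
    induction B using firstBlock_induction with
    | hadd X X' h h' => simp only [map_add, symTrace_add_left, h, h']
    | hsmul c X h => simp only [map_smul, symTrace_smul_left, h]
    | h y =>
      rw [symTrace_rotate, symTrace_rotate (firstBlock y)]
      induction C using firstBlock_induction with
      | hadd X X' h h' => simp only [map_add, symTrace_add_left, h, h']
      | hsmul c X h => simp only [map_smul, symTrace_smul_left, h]
      | h z =>
        rw [symTrace_rotate, symTrace_rotate (firstBlock z)]
        simp only [permRep_firstBlock, symTrace_firstBlock, h]

theorem sum_firstBlock : ∑ x, firstBlock x = (6 : ℂ) • (1 : Mat 3) := by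
  have h := congrArg eisensteinHom.mapMatrix sum_firstEis
  rw [map_sum, map_nsmul, map_one] at h
  simp only [RingHom.mapMatrix_apply, ← firstBlock_eq_map] at h
  rw [h, ← Nat.cast_smul_eq_nsmul ℂ]
  norm_num

theorem permRep_one (π : Equiv.Perm Label) : permRep π 1 = 1 := by
  have h := congrArg (permRep π) sum_firstBlock
  rw [map_sum, map_smul] at h
  simp only [permRep_firstBlock] at h
  rw [Equiv.sum_comp π firstBlock, sum_firstBlock] at h
  exact (smul_right_injective _ (by norm_num : (6 : ℂ) ≠ 0) h).symm

theorem firstBlock_transpose (x : Label) : (firstBlock x)ᵀ = firstBlock (swapLabel x) := by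
  rw [firstBlock_eq_map, firstBlock_eq_map, ← firstEis_transpose, Matrix.transpose_map]

end FirstBlock

/-! ### The second block -/

section SecondBlock

theorem aCoeff_ne_zero : aCoeff ≠ 0 := by
  rw [aCoeff, Complex.ofReal_ne_zero, neg_ne_zero]
  positivity

/-- The additive characters of `𝔽₃²`, parametrized by the symplectic form. -/
def labelChar (d : ZMod 3) : ℂ := eisensteinHom (rootEis d)

theorem labelChar_add (a b : ZMod 3) : labelChar (a + b) = labelChar a * labelChar b := by
  rw [labelChar, rootEis_add, map_mul, labelChar, labelChar]

theorem labelChar_zero : labelChar 0 = 1 := by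
  rw [labelChar, rootEis_zero, map_one]

theorem labelChar_pow_three (d : ZMod 3) : labelChar d ^ 3 = 1 := by
  rw [labelChar, ← map_pow, rootEis_pow_three, map_one]

theorem labelChar_ne_zero (d : ZMod 3) : labelChar d ≠ 0 := by
  intro h
  have := labelChar_pow_three d
  rw [h] at this
  norm_num at this

theorem labelChar_injective : Function.Injective labelChar :=
  eisensteinHom_injective.comp rootEis_injective

/-- The second block consists of multiples of the Fourier coefficients of the first block. -/
theorem exists_sum_labelChar_smul (x : Label) (hx : x ≠ 0) : ∃ j : ZMod 3,
    ∑ y, labelChar (labelForm x y) • firstBlock y = (-3 * labelChar j) • secondBlock x := by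
  obtain ⟨j, hj⟩ := exists_sum_rootEis_smul_firstEis x hx
  refine ⟨j, ?_⟩
  have h := congrArg eisensteinHom.mapMatrix hj
  have hs : ∀ (c : Eisenstein) (A : Matrix (Fin 3) (Fin 3) Eisenstein),
      eisensteinHom.mapMatrix (c • A) = eisensteinHom c • A.map eisensteinHom := by
    intro c A
    ext i k
    simp
  rw [map_sum] at h
  simp only [hs, ← firstBlock_eq_map, ← secondBlock_eq_map x hx] at h
  rw [map_mul, map_neg, map_ofNat] at h
  exact h

theorem exists_secondBlock_eq (x : Label) : ∃ c : ℂ, c ≠ 0 ∧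
    secondBlock x = c • ∑ y, labelChar (labelForm x y) • firstBlock y := by
  by_cases hx : x = 0
  · subst hx
    refine ⟨aCoeff / 6, div_ne_zero aCoeff_ne_zero (by norm_num), ?_⟩
    simp only [labelForm, Pi.zero_apply, zero_mul, sub_zero, labelChar_zero, one_smul]
    rw [sum_firstBlock, secondBlock_zero, smul_smul]
    congr 1
    ring
  · obtain ⟨j, hj⟩ := exists_sum_labelChar_smul x hx
    have h0 : -3 * labelChar j ≠ 0 := mul_ne_zero (by norm_num) (labelChar_ne_zero j)
    exact ⟨(-3 * labelChar j)⁻¹, inv_ne_zero h0, by rw [hj, smul_smul, inv_mul_cancel₀ h0, one_smul]⟩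

theorem trace_secondBlock (x : Label) (hx : x ≠ 0) : (secondBlock x).trace = 0 := by
  have h : ∀ x : Label, x ≠ 0 → (secondEis x).trace = 0 := by
    simp only [forall_label]
    decide +kernel
  rw [secondBlock_eq_map x hx, trace_map_eisensteinHom, h x hx, map_zero]

/-- Multiples of members of the second block are equal only for equal labels. -/
theorem eq_of_secondBlock_eq_smul {x x' : Label} {c : ℂ}
    (h : secondBlock x = c • secondBlock x') : x = x' := by
  obtain ⟨k, hk, e⟩ := exists_secondBlock_eq x
  obtain ⟨k', -, e'⟩ := exists_secondBlock_eq x'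
  have hcoef : ∀ y, k * labelChar (labelForm x y) = c * k' * labelChar (labelForm x' y) := by
    rw [e, e', smul_smul, Finset.smul_sum, Finset.smul_sum] at h
    simp only [smul_smul, ← firstBasis_apply] at h
    intro y
    have := congrArg (fun X => firstBasis.repr X y) h
    simpa [Finsupp.single_apply] using this
  have h0 := hcoef 0
  -- Both characters are 1 at the label 0, so the scalars agree and cancel, leaving equality of the
  -- characters.
  simp only [labelForm, Pi.zero_apply, mul_zero, sub_zero, labelChar_zero, mul_one] at h0
  rw [← h0] at hcoef
  have hform : ∀ y, labelForm x y = labelForm x' y :=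
    fun y => labelChar_injective (mul_left_cancel₀ hk (hcoef y))
  have h1 := hform ![1, 0]
  have h2 := hform ![0, 1]
  simp [labelForm] at h1 h2
  ext i
  fin_cases i
  exacts [h2, h1]

/-- A scalar matrix pairs equally with all P_z, whereas P_x does not; the other members of the
second block are traceless, whereas tr P_x = 2. -/
theorem firstBlock_ne_smul_secondBlock (x y : Label) (c : ℂ) :
    firstBlock x ≠ c • secondBlock y := by
  intro h
  by_cases hy : y = 0
  · subst hy
    have key : ∀ z, (if x = z then (4 : ℂ) else 1) = c * aCoeff * 2 := by
      intro z
      rw [← trace_firstBlock_mul, h, secondBlock_zero, smul_smul, Matrix.smul_mul, one_mul,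
        Matrix.trace_smul, trace_firstBlock, smul_eq_mul]
    obtain ⟨z, hz⟩ := exists_ne x
    have h1 := key x
    rw [← key z, if_pos rfl, if_neg hz.symm] at h1
    norm_num at h1
  · have := congrArg Matrix.trace h
    rw [trace_firstBlock, Matrix.trace_smul, trace_secondBlock y hy] at this
    simp at this

/-- A linear map that permutes the first block and is compatible with a character maps the
corresponding members of the second block to each other, up to cube roots of unity. -/
theorem cube_permRep_secondBlock {π : Equiv.Perm Label} {x x' : Label} (hx : x ≠ 0) (hx' : x' ≠ 0)
    (d : ZMod 3) (h : ∀ y, labelForm x y = labelForm x' (π y) + d) :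
    cube (permRep π (secondBlock x)) = cube (secondBlock x') := by
  obtain ⟨j, hj⟩ := exists_sum_labelChar_smul x hx
  obtain ⟨j', hj'⟩ := exists_sum_labelChar_smul x' hx'
  have e := congrArg (permRep π) hj
  rw [map_sum, map_smul] at e
  simp only [map_smul, permRep_firstBlock, h, labelChar_add, mul_comm _ (labelChar d),
    mul_smul] at e
  rw [← Finset.smul_sum, Equiv.sum_comp π (fun y => labelChar (labelForm x' y) • firstBlock y),
    hj'] at e
  have e2 := congrArg cube e
  simp only [cube_smul, mul_pow, labelChar_pow_three, smul_smul, one_mul, mul_one] at e2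
  exact (smul_right_injective _ (by norm_num : ((-3 : ℂ) ^ 3) ≠ 0) e2).symm

theorem permRep_secondBlock_zero (π : Equiv.Perm Label) :
    permRep π (secondBlock 0) = secondBlock 0 := by
  rw [secondBlock_zero, map_smul, permRep_one]

end SecondBlock

/-! ### The action of the abstract group on the labels -/

section LabelAction

/-- The interchange of the two coordinates as a permutation of the labels. -/
def swapPerm : Equiv.Perm Label := ⟨swapLabel, swapLabel, swapLabel_swapLabel, swapLabel_swapLabel⟩

/-- The natural action of the affine group on the labels. -/
def affinePerm : AffineSL →* Equiv.Perm Label :=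
  MonoidHom.toHomPerm
    { toFun := fun g x => g.right.1 *ᵥ x + Multiplicative.toAdd g.left
      map_one' := funext fun x => by
        change (1 : Matrix (Fin 2) (Fin 2) (ZMod 3)) *ᵥ x + 0 = x
        rw [Matrix.one_mulVec, add_zero]
      map_mul' := fun g h => funext fun x => by
        change (g.right.1 * h.right.1) *ᵥ x +
            (Multiplicative.toAdd g.left + g.right.1 *ᵥ Multiplicative.toAdd h.left) =
          g.right.1 *ᵥ (h.right.1 *ᵥ x + Multiplicative.toAdd h.left) + Multiplicative.toAdd g.left
        rw [Matrix.mulVec_add, Matrix.mulVec_mulVec]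
        abel }

theorem affinePerm_apply (g : AffineSL) (x : Label) :
    affinePerm g x = g.right.1 *ᵥ x + Multiplicative.toAdd g.left := rfl

theorem affinePerm_mk (v : Label) (M : SL(2, ZMod 3)) (x : Label) :
    affinePerm (AffineSL.mk v M) x = M.1 *ᵥ x + v := rfl

theorem swapPerm_mul_self : swapPerm * swapPerm = 1 := Equiv.ext swapLabel_swapLabel

theorem affinePerm_swapAut (g : AffineSL) :
    affinePerm (swapAut g) = swapPerm * affinePerm g * swapPerm⁻¹ := by
  rw [eq_mul_inv_iff_mul_eq]
  ext1 x
  change (swapSL g.right).1 *ᵥ swapLabel x + swapLabel (Multiplicative.toAdd g.left) =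
    swapLabel (g.right.1 *ᵥ x + Multiplicative.toAdd g.left)
  rw [add_comm, ← swapLabel_add_mulVec, add_comm]

/-- The action of `ℤ₂` on the labels by the interchange of coordinates. -/
def swapHom : Multiplicative (ZMod 2) →* Equiv.Perm Label where
  toFun k := swapPerm ^ (Multiplicative.toAdd k).val
  map_one' := pow_zero _
  map_mul' k l := by
    rw [toAdd_mul, ZMod.val_add, ← pow_add]
    exact (pow_eq_pow_mod _ (by rw [pow_two, swapPerm_mul_self])).symm

/-- The action of `(ℤ₃² ⋊ SL(2, 𝔽₃)) ⋊ ℤ₂` on the labels. -/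
def hessePerm : HesseGroup →* Equiv.Perm Label :=
  SemidirectProduct.lift affinePerm swapHom fun k => by
    ext1 g
    change affinePerm ((swapAut ^ (Multiplicative.toAdd k).val) g) =
      swapPerm ^ (Multiplicative.toAdd k).val * affinePerm g *
        (swapPerm ^ (Multiplicative.toAdd k).val)⁻¹
    induction (Multiplicative.toAdd k).val with
    | zero => simp
    | succ m ih =>
      rw [pow_succ', MulAut.mul_apply, affinePerm_swapAut, ih, pow_succ']
      group

theorem hessePerm_inl (g : AffineSL) : hessePerm (SemidirectProduct.inl g) = affinePerm g :=
  SemidirectProduct.lift_inl _ _ _ _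

theorem hessePerm_inr_one :
    hessePerm (SemidirectProduct.inr (Multiplicative.ofAdd 1)) = swapPerm :=
  (SemidirectProduct.lift_inr _ _ _ _).trans (pow_one swapPerm)

theorem hesseGroup_cases (h : HesseGroup) : (∃ g, h = SemidirectProduct.inl g) ∨
    ∃ g, h = SemidirectProduct.inl g * SemidirectProduct.inr (Multiplicative.ofAdd 1) := by
  obtain ⟨g, k⟩ := h
  have hk : k = 1 ∨ k = Multiplicative.ofAdd 1 := by
    revert k
    decide
  obtain rfl | rfl := hk
  · exact Or.inl ⟨g, rfl⟩
  · exact Or.inr ⟨g, SemidirectProduct.mk_eq_inl_mul_inr _ _⟩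

theorem labelForm_mulVec (M : SL(2, ZMod 3)) (x y : Label) :
    labelForm (M.1 *ᵥ x) (M.1 *ᵥ y) = labelForm x y := by
  have h := M.2
  rw [Matrix.det_fin_two] at h
  simp only [labelForm, Matrix.mulVec, dotProduct, Fin.sum_univ_two]
  linear_combination (x 0 * y 1 - x 1 * y 0) * h

theorem labelForm_affinePerm (g : AffineSL) (x y z : Label) :
    labelForm (affinePerm g y - affinePerm g x) (affinePerm g z - affinePerm g x) =
      labelForm (y - x) (z - x) := by
  simp only [affinePerm_apply, add_sub_add_right_eq_sub, ← Matrix.mulVec_sub, labelForm_mulVec]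

theorem labelForm_swapLabel (x y : Label) :
    labelForm (swapLabel x) (swapLabel y) = -labelForm x y := by
  simp [labelForm, swapLabel]

theorem swapLabel_sub (x y : Label) : swapLabel (x - y) = swapLabel x - swapLabel y := by
  ext i
  fin_cases i <;> rfl

theorem labelForm_swapPerm (x y z : Label) :
    labelForm (swapPerm y - swapPerm x) (swapPerm z - swapPerm x) =
      -labelForm (y - x) (z - x) := by
  change labelForm (swapLabel y - swapLabel x) (swapLabel z - swapLabel x) = _
  rw [← swapLabel_sub, ← swapLabel_sub, labelForm_swapLabel]

/-- The elements outside of the affine group reverse the orientation of the labels. -/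
theorem exists_eq_inl_of_labelForm {h : HesseGroup}
    (hform : labelForm (hessePerm h ![1, 0] - hessePerm h 0) (hessePerm h ![0, 1] - hessePerm h 0) =
      labelForm (![1, 0] - 0) (![0, 1] - 0)) : ∃ g, h = SemidirectProduct.inl g := by
  obtain hg | ⟨g, rfl⟩ := hesseGroup_cases h
  · exact hg
  · exfalso
    rw [map_mul, hessePerm_inl, hessePerm_inr_one] at hform
    simp only [Equiv.Perm.mul_apply] at hform
    rw [labelForm_affinePerm, labelForm_swapPerm] at hform
    revert hform
    decide

theorem hessePerm_injective : Function.Injective hessePerm := by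
  rw [injective_iff_map_eq_one]
  intro h h1
  -- The identity permutation preserves orientation, so the kernel lies in the affine subgroup.
  obtain ⟨g, rfl⟩ := exists_eq_inl_of_labelForm (h := h) (by rw [h1]; rfl)
  rw [hessePerm_inl] at h1
  have hv : Multiplicative.toAdd g.left = 0 := by
    have := Equiv.congr_fun h1 0
    rwa [affinePerm_apply, Matrix.mulVec_zero, zero_add] at this
  have hM : g.right = 1 := by
    apply Subtype.ext
    apply Matrix.ext_of_mulVec_single
    intro i
    have := Equiv.congr_fun h1 (Pi.single i 1)
    rw [affinePerm_apply, hv, add_zero] at this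
    exact this.trans (Matrix.one_mulVec _).symm
  rw [map_eq_one_iff _ SemidirectProduct.inl_injective]
  exact SemidirectProduct.ext hv hM

/-- Permutations of the labels that preserve collinearity come from the abstract group. -/
theorem exists_hessePerm_eq {π : Equiv.Perm Label}
    (hπ : ∀ x y, x ≠ y → π (-(x + y)) = -(π x + π y)) : ∃ h, hessePerm h = π := by
  have hπ' : ∀ x y, π (-(x + y)) = -(π x + π y) := by
    intro x y
    by_cases hxy : x = y
    · subst hxy
      have h : ∀ z : Label, -(z + z) = z := fun z => by
        rw [neg_eq_iff_add_eq_zero]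
        exact three_nsmul_label z
      rw [h, h]
    · exact hπ x y hxy
  have hneg : ∀ x, π (-x) - π 0 = -(π x - π 0) := by
    intro x
    have h1 := hπ' x 0
    rw [add_zero] at h1
    rw [h1, ← sub_eq_zero, ← neg_eq_zero]
    refine Eq.trans ?_ (three_nsmul_label (π 0))
    abel
  -- Preserving the third point of each line makes π affine: after subtraction of π 0 it is
  -- additive, hence linear over the prime field 𝔽₃.
  let ρ : Label →+ Label := AddMonoidHom.mk' (fun x => π x - π 0) fun x y => by
    rw [← neg_inj, ← hneg, hπ' x y, ← sub_eq_zero, ← neg_eq_zero]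
    refine Eq.trans ?_ (three_nsmul_label (π 0))
    abel
  let A : Matrix (Fin 2) (Fin 2) (ZMod 3) := LinearMap.toMatrix' (ρ.toZModLinearMap 3)
  have hA : ∀ x, A *ᵥ x = π x - π 0 := fun x => LinearMap.toMatrix'_mulVec (ρ.toZModLinearMap 3) x
  have hdet : A.det ≠ 0 := by
    have hinj : Function.Injective A.mulVec := fun x y hxy => π.injective (by
      simpa [hA] using hxy)
    exact ((Matrix.isUnit_iff_isUnit_det A).1 (Matrix.mulVec_injective_iff_isUnit.1 hinj)).ne_zero
  have hcases : ∀ d : ZMod 3, d ≠ 0 → d = 1 ∨ d = -1 := by decide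
  obtain h1 | h1 := hcases _ hdet
  · obtain ⟨N, hN⟩ : ∃ N : SL(2, ZMod 3), N.1 = A := ⟨⟨A, h1⟩, rfl⟩
    refine ⟨SemidirectProduct.inl (AffineSL.mk (π 0) N), Equiv.ext fun x => ?_⟩
    rw [hessePerm_inl, affinePerm_mk, hN, hA, sub_add_cancel]
  -- Determinant -1 is absorbed by the interchange of coordinates.
  · have h2 : (A * !![0, 1; 1, 0]).det = 1 := by
      rw [Matrix.det_mul, h1, Matrix.det_fin_two_of]
      norm_num
    obtain ⟨N, hN⟩ : ∃ N : SL(2, ZMod 3), N.1 = A * !![0, 1; 1, 0] := ⟨⟨_, h2⟩, rfl⟩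
    refine ⟨SemidirectProduct.inl (AffineSL.mk (π 0) N) *
      SemidirectProduct.inr (Multiplicative.ofAdd 1), Equiv.ext fun x => ?_⟩
    rw [map_mul, hessePerm_inl, hessePerm_inr_one, Equiv.Perm.mul_apply, affinePerm_mk]
    have h3 : !![0, 1; 1, 0] *ᵥ swapPerm x = x := by
      change !![0, 1; 1, 0] *ᵥ swapLabel x = x
      ext i
      fin_cases i <;> simp [swapLabel, Matrix.mulVec, dotProduct, Fin.sum_univ_two]
    rw [hN, ← Matrix.mulVec_mulVec, h3, hA, sub_add_cancel]

theorem card_hesseGroup : Nat.card HesseGroup = 432 := by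
  have h : Nat.card SL(2, ZMod 3) = 24 := by
    rw [Nat.card_eq_fintype_card]
    decide +kernel
  have h9 : Nat.card (Multiplicative Label) = 9 := by
    rw [Nat.card_eq_fintype_card]
    exact card_label
  have h2 : Nat.card (Multiplicative (ZMod 2)) = 2 := by
    rw [Nat.card_eq_fintype_card]
    rfl
  rw [SemidirectProduct.card, SemidirectProduct.card, h, h9, h2]

/-- The transvection `(x, y) ↦ (x, x + y)`. -/
def lowerSL : SL(2, ZMod 3) := ⟨!![1, 0; 1, 1], by decide⟩

/-- The transvection `(x, y) ↦ (x - y, y)`. -/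
def upperSL : SL(2, ZMod 3) := ⟨!![1, -1; 0, 1], by decide⟩

/-- Reduces the realization of SL(2, 𝔽₃) by conjugations to two shear operators. -/
theorem exists_eq_mul_transvections : ∀ M : SL(2, ZMod 3), ∃ i j k l : Fin 3,
    M = upperSL ^ i.val * lowerSL ^ j.val * upperSL ^ k.val * lowerSL ^ l.val := by
  decide +kernel

end LabelAction

/-! ### The symmetry group -/

section SymmetryGroup

/-- The transformations of `S³(V* ⊗ V)` that permute the cubes of the first block. -/
def cubeRep : Equiv.Perm Label →* (Sym3 (Mat 3) ≃ₗ[ℂ] Sym3 (Mat 3)) :=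
  (cubeAction (Mat 3)).comp permRep

theorem cubeRep_cube (π : Equiv.Perm Label) (X : Mat 3) :
    cubeRep π (cube X) = cube (permRep π X) :=
  cubeAction_cube _ _ _

theorem cubeRep_firstBlock (π : Equiv.Perm Label) (x : Label) :
    cubeRep π (cube (firstBlock x)) = cube (firstBlock (π x)) := by
  rw [cubeRep_cube, permRep_firstBlock]

theorem firstBlock_ne_zero (x : Label) : firstBlock x ≠ 0 := by
  rw [← firstBasis_apply]
  exact firstBasis.ne_zero x

theorem secondBlock_ne_zero (x : Label) : secondBlock x ≠ 0 := by
  intro h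
  obtain ⟨y, hy⟩ := exists_ne x
  exact hy.symm (eq_of_secondBlock_eq_smul (c := 0) (by rw [h, zero_smul]))

theorem firstBlock_injective : Function.Injective firstBlock :=
  linearIndependent_firstBlock.injective

theorem cube_firstBlock_injective : Function.Injective fun x => cube (firstBlock x) := by
  intro x y h
  obtain ⟨c, -, e⟩ := exists_eq_smul_of_cube_eq h (firstBlock_ne_zero y)
  have h1 := congrArg Matrix.trace e
  rw [Matrix.trace_smul, trace_firstBlock, trace_firstBlock, smul_eq_mul] at h1
  have hc : c = 1 := by linear_combination -h1 / 2
  rw [hc, one_smul] at e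
  exact firstBlock_injective e

theorem cube_secondBlock_injective : Function.Injective fun x => cube (secondBlock x) := by
  intro x y h
  obtain ⟨c, -, e⟩ := exists_eq_smul_of_cube_eq h (secondBlock_ne_zero y)
  exact eq_of_secondBlock_eq_smul e

theorem ncard_decompositionSet : decompositionSet.ncard = 18 := by
  have h9 : ∀ f : Label → Sym3 (Mat 3), Function.Injective f → (Set.range f).ncard = 9 := by
    intro f hf
    rw [← Set.image_univ, Set.ncard_image_of_injective _ hf, Set.ncard_univ,
      Nat.card_eq_fintype_card, card_label]
  rw [decompositionSet, Set.ncard_union_eq, h9 _ cube_firstBlock_injective,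
    h9 _ cube_secondBlock_injective]
  rw [Set.disjoint_left]
  rintro _ ⟨x, rfl⟩ ⟨y, h⟩
  obtain ⟨c, -, e⟩ := exists_eq_smul_of_cube_eq h.symm (secondBlock_ne_zero y)
  exact firstBlock_ne_smul_secondBlock _ _ _ e

theorem cubeRep_injective : Function.Injective cubeRep := by
  intro π σ h
  ext1 x
  apply cube_firstBlock_injective
  change cube (firstBlock (π x)) = cube (firstBlock (σ x))
  rw [← cubeRep_firstBlock, h, cubeRep_firstBlock]

/-- A criterion for a permutation of the labels to induce an element of `Γ_S`. -/
theorem cubeRep_mem_GammaS {π τ : Equiv.Perm Label}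
    (h : ∀ x y z, tripleGram (π x) (π y) (π z) + tripleGram (π x) (π z) (π y) =
      tripleGram x y z + tripleGram x z y)
    (hτ : ∀ x, cubeRep π (cube (secondBlock x)) = cube (secondBlock (τ x))) :
    cubeRep π ∈ GammaS := by
  refine ⟨⟨⟨permRep π, rfl⟩, ?_⟩, ?_⟩
  · exact (cubeAction_sM_iff_of_orthogonal (trace_permRep_mul π)).2 (symTrace_permRep h)
  · change cubeRep π • decompositionSet = decompositionSet
    rw [decompositionSet, Set.smul_set_union]
    have key : ∀ (f : Label → Mat 3) (σ : Equiv.Perm Label),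
        (∀ x, cubeRep π (cube (f x)) = cube (f (σ x))) →
        cubeRep π • Set.range (fun x => cube (f x)) = Set.range (fun x => cube (f x)) := by
      intro f σ hσ
      rw [← Set.image_smul, ← Set.range_comp]
      have : (fun t => cubeRep π • t) ∘ (fun x => cube (f x)) = (fun x => cube (f x)) ∘ σ :=
        funext hσ
      rw [this, σ.surjective.range_comp]
    rw [key _ π (cubeRep_firstBlock π), key _ τ hτ]

/-- The linear part of an affine transformation of the labels. -/
def linearPerm (M : SL(2, ZMod 3)) : Equiv.Perm Label := affinePerm (AffineSL.mk 0 M)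

theorem linearPerm_apply (M : SL(2, ZMod 3)) (x : Label) : linearPerm M x = M.1 *ᵥ x :=
  add_zero _

theorem cubeRep_affinePerm_secondBlock (v : Label) (M : SL(2, ZMod 3)) (x : Label) :
    cubeRep (affinePerm (AffineSL.mk v M)) (cube (secondBlock x)) =
      cube (secondBlock (M.1 *ᵥ x)) := by
  rw [cubeRep_cube]
  by_cases hx : x = 0
  · subst hx
    rw [Matrix.mulVec_zero, permRep_secondBlock_zero]
  -- [x, y] = [Mx, My + v] - [Mx, v]: the translation contributes only a constant cube root of
  -- unity, which is why the second block sees just the linear part.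
  · refine cube_permRep_secondBlock hx (fun h => hx ?_) (-labelForm (M.1 *ᵥ x) v) fun y => ?_
    · apply (linearPerm M).injective
      rw [linearPerm_apply, linearPerm_apply, h, Matrix.mulVec_zero]
    · rw [affinePerm_mk, ← labelForm_mulVec M x y]
      simp only [labelForm, Pi.add_apply]
      ring

theorem cubeRep_affinePerm_mem (g : AffineSL) : cubeRep (affinePerm g) ∈ GammaS := by
  have h := tripleGram_comp (affinePerm g).injective (labelForm_affinePerm g)
  exact cubeRep_mem_GammaS (τ := linearPerm g.right) (fun x y z => by rw [h, h])
    fun x => (cubeRep_affinePerm_secondBlock (Multiplicative.toAdd g.left) g.right x).trans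
      (by rw [linearPerm_apply])

theorem permRep_swapPerm : permRep swapPerm = Matrix.transposeLinearEquiv (Fin 3) (Fin 3) ℂ ℂ :=
  (eq_permRep firstBlock_transpose).symm

theorem cubeRep_swapPerm : cubeRep swapPerm = transposition 3 := by
  rw [cubeRep, MonoidHom.comp_apply, permRep_swapPerm, transposition]

theorem cubeRep_swapPerm_mem : cubeRep swapPerm ∈ GammaS := by
  -- The interchange s of coordinates reverses the symplectic form, so [x, y] = [-sx, sy]; hence the
  -- sign on the second block.
  refine cubeRep_mem_GammaS (τ := (Equiv.neg Label) * swapPerm) (fun x y z => ?_) fun x => ?_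
  · apply eisensteinHom_injective
    rw [← symTrace_firstBlock, ← symTrace_firstBlock]
    change symTrace (firstBlock (swapLabel x)) (firstBlock (swapLabel y))
      (firstBlock (swapLabel z)) = _
    simp only [← firstBlock_transpose, symTrace]
    rw [← Matrix.transpose_mul, ← Matrix.transpose_mul, ← Matrix.transpose_mul,
      ← Matrix.transpose_mul, Matrix.trace_transpose, Matrix.trace_transpose,
      Matrix.trace_mul_comm, Matrix.trace_mul_comm (firstBlock y), add_comm,
      Matrix.trace_mul_cycle (firstBlock x), Matrix.trace_mul_cycle (firstBlock x)]
  · rw [cubeRep_cube]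
    change _ = cube (secondBlock (-swapLabel x))
    by_cases hx : x = 0
    · subst hx
      have h0 : -swapLabel 0 = 0 := by decide
      rw [h0, permRep_secondBlock_zero]
    · refine cube_permRep_secondBlock hx (fun h => hx ?_) 0 fun y => ?_
      · rw [neg_eq_zero] at h
        rw [← swapLabel_swapLabel x, h]
        decide
      · change _ = labelForm _ (swapLabel y) + 0
        simp [labelForm, swapLabel]
        ring

/-- A linear map that fixes `sM_⟨3⟩` and the unit matrix and maps the decomposition to itself
permutes the first block. -/
theorem exists_eq_permRep {g : Mat 3 ≃ₗ[ℂ] Mat 3} (hg : cubeAction (Mat 3) g (sM 3) = sM 3)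
    (h1 : g 1 = 1) (hS : ∀ t ∈ decompositionSet, cubeAction (Mat 3) g t ∈ decompositionSet) :
    ∃ π, g = permRep π := by
  have key : ∀ x, ∃ y, g (firstBlock x) = firstBlock y := by
    intro x
    have hx := hS _ (Or.inl ⟨x, rfl⟩)
    rw [cubeAction_cube] at hx
    have htr := trace_map hg h1 (firstBlock x)
    obtain ⟨y, hy⟩ | ⟨y, hy⟩ := hx
    · obtain ⟨c, -, e⟩ := exists_eq_smul_of_cube_eq hy.symm (firstBlock_ne_zero y)
      rw [e, Matrix.trace_smul, trace_firstBlock, trace_firstBlock, smul_eq_mul] at htr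
      have hc : c = 1 := by linear_combination htr / 2
      exact ⟨y, by rw [e, hc, one_smul]⟩
    · exfalso
      obtain ⟨c, -, e⟩ := exists_eq_smul_of_cube_eq hy.symm (secondBlock_ne_zero y)
      by_cases hy0 : y = 0
      · refine firstBlock_ne_smul_secondBlock x 0 c (g.injective ?_)
        rw [e, hy0, secondBlock_zero, map_smul, map_smul, h1]
      · rw [e, Matrix.trace_smul, trace_firstBlock, trace_secondBlock y hy0, smul_zero] at htr
        exact two_ne_zero htr.symm
  choose π hπ using key
  have hinj : Function.Injective π := by
    intro x y hxy
    apply firstBlock_injective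
    apply g.injective
    rw [hπ, hπ, hxy]
  exact ⟨Equiv.ofBijective π (Finite.injective_iff_bijective.1 hinj), eq_permRep hπ⟩

theorem maps_decompositionSet {γ : Sym3 (Mat 3) ≃ₗ[ℂ] Sym3 (Mat 3)} (hγ : γ ∈ GammaS) :
    ∀ t ∈ decompositionSet, γ t ∈ decompositionSet := by
  intro t ht
  have h : γ • decompositionSet = decompositionSet := hγ.2
  rw [← h]
  exact Set.smul_mem_smul_set ht

/-- The elements of `Γ_S` are induced by linear maps that permute the first block. -/
theorem exists_eq_cubeRep {γ : Sym3 (Mat 3) ≃ₗ[ℂ] Sym3 (Mat 3)} (hγ : γ ∈ GammaS) :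
    ∃ π, γ = cubeRep π := by
  obtain ⟨⟨⟨g, rfl⟩, hg⟩, -⟩ := id hγ
  have hg' : cubeAction (Mat 3) g (sM 3) = sM 3 := hg
  obtain ⟨c, hc⟩ := exists_map_one_eq_smul hg'
  have hQ : g (secondBlock 0) = c • secondBlock 0 := by
    rw [secondBlock_zero, map_smul, hc, smul_comm]
  have hc0 : c ≠ 0 := by
    rintro rfl
    rw [zero_smul, LinearEquiv.map_eq_zero_iff] at hQ
    exact secondBlock_ne_zero 0 hQ
  -- The image of the cube of Q_0 lies in S, and Q_0 is the only one of the eighteen matrices that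
  -- is a multiple of I. So the cube of c·Q_0 is that of Q_0.
  have hc3 : c ^ 3 = 1 := by
    have hx := maps_decompositionSet hγ _ (Or.inr ⟨0, rfl⟩)
    rw [cubeAction_cube, hQ] at hx
    obtain ⟨y, hy⟩ | ⟨y, hy⟩ := hx
    · obtain ⟨ω, -, e⟩ := exists_eq_smul_of_cube_eq hy
        (smul_ne_zero hc0 (secondBlock_ne_zero 0))
      rw [smul_smul] at e
      exact absurd e (firstBlock_ne_smul_secondBlock _ _ _)
    · obtain ⟨ω, hω, e⟩ := exists_eq_smul_of_cube_eq hy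
        (smul_ne_zero hc0 (secondBlock_ne_zero 0))
      rw [smul_smul] at e
      obtain rfl := eq_of_secondBlock_eq_smul e
      have h1 : ω * c = 1 := smul_left_injective ℂ (secondBlock_ne_zero 0) (by
        change (ω * c) • _ = (1 : ℂ) • _
        rw [one_smul, ← e])
      have h2 := congrArg (· ^ 3) h1
      simpa [mul_pow, hω] using h2
  let g' : Mat 3 ≃ₗ[ℂ] Mat 3 := LinearEquiv.smulOfNeZero ℂ (Mat 3) c⁻¹ (inv_ne_zero hc0) * g
  have hgg' : cubeAction (Mat 3) g' = cubeAction (Mat 3) g :=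
    cubeAction_eq_of_eq_smul (c := c⁻¹) (by rw [inv_pow, hc3, inv_one]) fun _ => rfl
  have h1 : g' 1 = 1 := by
    change c⁻¹ • g 1 = 1
    rw [hc, smul_smul, inv_mul_cancel₀ hc0, one_smul]
  rw [← hgg'] at hγ hg' ⊢
  obtain ⟨π, hπ⟩ := exists_eq_permRep hg' h1 (maps_decompositionSet hγ)
  exact ⟨π, by rw [hπ]; rfl⟩

/-- The elements of `Γ_S` come from the abstract group. -/
theorem exists_eq_cubeRep_hessePerm {γ : Sym3 (Mat 3) ≃ₗ[ℂ] Sym3 (Mat 3)} (hγ : γ ∈ GammaS) :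
    ∃ h, cubeRep (hessePerm h) = γ := by
  obtain ⟨π, rfl⟩ := exists_eq_cubeRep hγ
  have hsym := (cubeAction_sM_iff_of_orthogonal (trace_permRep_mul π)).1 hγ.1.2
  have htriple : ∀ x y z, tripleGram (π x) (π y) (π z) + tripleGram (π x) (π z) (π y) =
      tripleGram x y z + tripleGram x z y := by
    intro x y z
    apply eisensteinHom_injective
    have h := hsym (firstBlock x) (firstBlock y) (firstBlock z)
    rwa [permRep_firstBlock, permRep_firstBlock, permRep_firstBlock, symTrace_firstBlock,
      symTrace_firstBlock] at h
  obtain ⟨h, rfl⟩ := exists_hessePerm_eq (π := π) fun x y hxy => by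
    have hthird : ∀ x y : Label, x ≠ y → y ≠ -(x + y) ∧ -(x + y) ≠ x := by
      simp only [forall_label]
      decide +kernel
    obtain ⟨hyz, hzx⟩ := hthird x y hxy
    have h0 := (tripleGram_add_eq_iff (π.injective.ne hxy) (π.injective.ne hyz)
      (π.injective.ne hzx)).1 (by
        rw [htriple, tripleGram_add_eq_iff hxy hyz hzx, add_neg_cancel])
    exact eq_neg_of_add_eq_zero_right h0
  exact ⟨h, rfl⟩

theorem cubeRep_hessePerm_mem (h : HesseGroup) : cubeRep (hessePerm h) ∈ GammaS := by
  obtain ⟨g, rfl⟩ | ⟨g, rfl⟩ := hesseGroup_cases h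
  · rw [hessePerm_inl]
    exact cubeRep_affinePerm_mem g
  · rw [map_mul, map_mul, hessePerm_inl, hessePerm_inr_one]
    exact mul_mem (cubeRep_affinePerm_mem g) cubeRep_swapPerm_mem

/-- The isomorphism of the abstract group with `Γ_S`. -/
def hesseEquiv : HesseGroup ≃* GammaS :=
  MulEquiv.ofBijective ((cubeRep.comp hessePerm).codRestrict GammaS cubeRep_hessePerm_mem)
    ⟨fun _ _ hhk => hessePerm_injective (cubeRep_injective (congrArg Subtype.val hhk)),
      fun γ => (exists_eq_cubeRep_hessePerm γ.2).imp fun _ hh => Subtype.ext hh⟩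

theorem coe_hesseEquiv (h : HesseGroup) :
    (hesseEquiv h : Sym3 (Mat 3) ≃ₗ[ℂ] Sym3 (Mat 3)) = cubeRep (hessePerm h) := rfl

end SymmetryGroup

/-! ### The elements that come from `PGL(V)` -/

section ProjectiveGroup

theorem conjGL_apply (p : GL (Fin 3) ℂ) (X : Mat 3) : conjGL p X = p.1 * X * p⁻¹.1 := rfl

/-- An operator that intertwines the first block with a permutation of it shows that the
permutation is induced by an element of `PGL(V)`. -/
theorem cubeRep_mem_pglSubgroup {π : Equiv.Perm Label} {p : Matrix (Fin 3) (Fin 3) Eisenstein}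
    (hdet : p.det ≠ 0) (h : ∀ x, p * firstEis x = firstEis (π x) * p) :
    cubeRep π ∈ pglSubgroup 3 := by
  have hdet' : (eisensteinHom.mapMatrix p).det ≠ 0 := by
    rw [← RingHom.map_det]
    exact (map_ne_zero_iff _ eisensteinHom_injective).2 hdet
  let q : GL (Fin 3) ℂ := Matrix.GeneralLinearGroup.mkOfDetNeZero _ hdet'
  refine ⟨QuotientGroup.mk q, ?_⟩
  change cubeAction (Mat 3) (conjGL q) = cubeAction (Mat 3) (permRep π)
  congr 1
  refine eq_permRep fun x => ?_
  have h1 := congrArg eisensteinHom.mapMatrix (h x)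
  rw [map_mul, map_mul, RingHom.mapMatrix_apply _ (firstEis x),
    RingHom.mapMatrix_apply _ (firstEis (π x)), ← firstBlock_eq_map, ← firstBlock_eq_map] at h1
  have h2 : q.1 * firstBlock x = firstBlock (π x) * q.1 := h1
  rw [conjGL_apply, h2, mul_assoc, Units.mul_inv, mul_one]

/-- The affine maps induced by conjugations form a subgroup, and it contains generators:
translations by Weyl operators, two transvections by shear operators. -/
theorem cubeRep_affinePerm_mem_pglSubgroup (g : AffineSL) :
    cubeRep (affinePerm g) ∈ pglSubgroup 3 := by
  let K : Subgroup AffineSL := (pglSubgroup 3).comap (cubeRep.comp affinePerm)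
  have hK : ∀ g, g ∈ K ↔ cubeRep (affinePerm g) ∈ pglSubgroup 3 := fun _ => Iff.rfl
  rw [← hK]
  have htrans : AffineSL.mk (Multiplicative.toAdd g.left) 1 ∈ K := by
    rw [hK]
    obtain ⟨hd, h⟩ := secondEis_mul_firstEis (Multiplicative.toAdd g.left)
    refine cubeRep_mem_pglSubgroup hd fun x => (h x).trans ?_
    rw [affinePerm_mk]
    congr 2
    rw [Matrix.SpecialLinearGroup.coe_one, Matrix.one_mulVec]
  have hlower : (SemidirectProduct.inr lowerSL : AffineSL) ∈ K := by
    rw [hK]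
    refine cubeRep_mem_pglSubgroup shearEis_lower.1 fun x => (shearEis_lower.2 x).trans ?_
    congr 2
    change _ = !![1, 0; 1, 1] *ᵥ x + 0
    ext i
    fin_cases i <;> simp [dotProduct, Fin.sum_univ_two]
  have hupper : (SemidirectProduct.inr upperSL : AffineSL) ∈ K := by
    rw [hK]
    refine cubeRep_mem_pglSubgroup shearEis_upper.1 fun x => (shearEis_upper.2 x).trans ?_
    congr 2
    change _ = !![1, -1; 0, 1] *ᵥ x + 0
    ext i
    fin_cases i <;> simp [dotProduct, Fin.sum_univ_two, sub_eq_add_neg]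
  have hlin : (SemidirectProduct.inr g.right : AffineSL) ∈ K := by
    obtain ⟨i, j, k, l, e⟩ := exists_eq_mul_transvections g.right
    rw [e]
    simp only [map_mul, map_pow]
    exact mul_mem (mul_mem (mul_mem (pow_mem hupper _) (pow_mem hlower _)) (pow_mem hupper _))
      (pow_mem hlower _)
  have : g = AffineSL.mk (Multiplicative.toAdd g.left) 1 * SemidirectProduct.inr g.right :=
    (SemidirectProduct.inl_left_mul_inr_right g).symm
  rw [this]
  exact mul_mem htrans hlin

/-- The elements of `Γ_S` that are induced by `PGL(V)` come from the affine group. -/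
theorem exists_eq_inl_of_mem_pglSubgroup {h : HesseGroup}
    (hh : cubeRep (hessePerm h) ∈ pglSubgroup 3) : ∃ g, h = SemidirectProduct.inl g := by
  obtain ⟨q, hq⟩ := hh
  obtain ⟨p, rfl⟩ := QuotientGroup.mk_surjective q
  have hp : cubeAction (Mat 3) (conjGL p) = cubeRep (hessePerm h) := hq
  have hmem := cubeRep_hessePerm_mem h
  have h1 : conjGL p 1 = 1 := by
    rw [conjGL_apply, mul_one, Units.mul_inv]
  obtain ⟨π, hπ⟩ := exists_eq_permRep (g := conjGL p) (by rw [hp]; exact hmem.1.2) h1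
    (by rw [hp]; exact maps_decompositionSet hmem)
  have hπh : π = hessePerm h := cubeRep_injective (by rw [← hp, hπ]; rfl)
  subst hπh
  -- Conjugation is multiplicative, so it preserves tr P_x P_y P_z without symmetrization.
  have htriple : ∀ x y z, tripleGram (hessePerm h x) (hessePerm h y) (hessePerm h z) =
      tripleGram x y z := by
    intro x y z
    apply eisensteinHom_injective
    rw [← trace_firstBlock_mul_mul, ← trace_firstBlock_mul_mul, ← permRep_firstBlock,
      ← permRep_firstBlock, ← permRep_firstBlock, ← hπ, conjGL_apply, conjGL_apply, conjGL_apply]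
    simp only [mul_assoc, Units.inv_mul_cancel_left]
    rw [Matrix.trace_mul_comm]
    simp only [mul_assoc, Units.inv_mul, mul_one]
  have hinj := (hessePerm h).injective
  have h01 : (0 : Label) ≠ ![1, 0] := by decide
  have h12 : (![1, 0] : Label) ≠ ![0, 1] := by decide
  have h20 : (![0, 1] : Label) ≠ 0 := by decide
  exact exists_eq_inl_of_labelForm (labelForm_eq_of_tripleGram_eq h01 h12 h20 (hinj.ne h01)
    (hinj.ne h12) (hinj.ne h20) (htriple _ _ _))

end ProjectiveGroup

/-! ### The Hesse configuration -/

section HesseConfiguration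

/-- A vector that spans the column space of a member of the first block. -/
def columnVec (x : Label) : Fin 3 → ℂ := fun i => eisensteinHom (columnEis x i)

theorem firstBlock_eq_vecMulVec (x : Label) :
    firstBlock x = vecMulVec (columnVec x) fun i => eisensteinHom (rowEis x i) := by
  rw [firstBlock_eq_map, firstEis_eq_vecMulVec]
  ext i j
  simp [vecMulVec_apply, columnVec]

theorem columnSpace_eq_span (x : Label) : columnSpace x = Submodule.span ℂ {columnVec x} := by
  apply le_antisymm
  · rintro _ ⟨u, rfl⟩
    rw [Matrix.toLin'_apply, firstBlock_eq_vecMulVec, Matrix.vecMulVec_mulVec, op_smul_eq_smul]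
    exact Submodule.smul_mem _ _ (Submodule.mem_span_singleton_self _)
  · rw [Submodule.span_singleton_le_iff_mem]
    -- P_x multiplies its own column vector by its trace 2.
    refine ⟨(1 / 2 : ℂ) • columnVec x, ?_⟩
    have h := trace_firstBlock x
    rw [firstBlock_eq_vecMulVec, Matrix.trace_vecMulVec] at h
    rw [map_smul, Matrix.toLin'_apply, firstBlock_eq_vecMulVec, Matrix.vecMulVec_mulVec,
      op_smul_eq_smul, dotProduct_comm, h, smul_smul]
    norm_num

theorem columnVec_ne_zero (x : Label) : columnVec x ≠ 0 := by
  intro h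
  refine firstBlock_ne_zero x ?_
  rw [firstBlock_eq_vecMulVec, h, Matrix.zero_vecMulVec]

theorem finrank_columnSpace (x : Label) : Module.finrank ℂ (columnSpace x) = 1 := by
  rw [columnSpace_eq_span]
  exact finrank_span_singleton (columnVec_ne_zero x)

theorem exists_columnVec_eq {x y z : Label} (hxy : x ≠ y) (h : x + y + z = 0) :
    ∃ a b : ℂ, columnVec z = a • columnVec x + b • columnVec y := by
  obtain ⟨a, b, s, t, e⟩ := exists_columnEis_eq x y hxy
  rw [← eq_neg_of_add_eq_zero_right h] at e
  refine ⟨eisensteinHom ((-1) ^ s.val * rootEis a), eisensteinHom ((-1) ^ t.val * rootEis b),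
    funext fun i => ?_⟩
  simpa [columnVec] using congrArg eisensteinHom (congrFun e i)

theorem add_eq_zero_of_columnVec_eq {x y z : Label} (hxy : x ≠ y) (hxz : x ≠ z) (hyz : y ≠ z)
    {a b : ℂ} (h : columnVec z = a • columnVec x + b • columnVec y) : x + y + z = 0 := by
  by_contra h0
  refine det_columnEis_ne_zero x y z hxy hxz hyz h0 (eisensteinHom_injective ?_)
  rw [RingHom.map_det, map_zero]
  have : eisensteinHom.mapMatrix (of ![columnEis x, columnEis y, columnEis z]) =
      of ![columnVec x, columnVec y, columnVec z] := by
    ext i j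
    fin_cases i <;> rfl
  rw [this, h, Matrix.det_fin_three]
  simp
  ring

theorem columnSpace_injective : Function.Injective columnSpace := by
  intro x y h
  by_contra hxy
  -- If the points x and y coincided, they would be dependent together with any third one; a label z
  -- off their line contradicts this.
  obtain ⟨z, hxz, hyz, h0⟩ : ∃ z, x ≠ z ∧ y ≠ z ∧ x + z + y ≠ 0 := by
    have h : ∀ x y : Label, x ≠ y → ∃ z, x ≠ z ∧ y ≠ z ∧ x + z + y ≠ 0 := by
      simp only [forall_label]
      decide +kernel
    exact h x y hxy
  have hy : columnVec y ∈ columnSpace x := by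
    rw [h, columnSpace_eq_span]
    exact Submodule.mem_span_singleton_self _
  rw [columnSpace_eq_span, Submodule.mem_span_singleton] at hy
  obtain ⟨a, ha⟩ := hy
  exact h0 (add_eq_zero_of_columnVec_eq hxz hxy hyz.symm (a := a) (b := 0)
    (by rw [zero_smul, add_zero, ha]))

theorem columnSpace_le_sup_iff {x y z : Label} (hxy : x ≠ y) (hxz : x ≠ z) (hyz : y ≠ z) :
    columnSpace z ≤ columnSpace x ⊔ columnSpace y ↔ x + y + z = 0 := by
  rw [columnSpace_eq_span, columnSpace_eq_span, columnSpace_eq_span,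
    Submodule.span_singleton_le_iff_mem, ← Submodule.span_union, Set.singleton_union,
    Submodule.mem_span_pair]
  constructor
  · rintro ⟨a, b, h⟩
    exact add_eq_zero_of_columnVec_eq hxy hxz hyz h.symm
  · intro h
    obtain ⟨a, b, e⟩ := exists_columnVec_eq hxy h
    exact ⟨a, b, e.symm⟩

end HesseConfiguration

end

theorem mainTheorem2 :
    decompositionSet.ncard = 18 ∧
    Nat.card GammaS = 432 ∧
    (∃ Φ : HesseGroup ≃* GammaS,
      -- the left factor corresponds to the elements that come from `PGL(V)`
      (∀ γ : GammaS, (γ : Sym3 (Mat 3) ≃ₗ[ℂ] Sym3 (Mat 3)) ∈ pglSubgroup 3 ↔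
        ∃ g : AffineSL, Φ (SemidirectProduct.inl g) = γ) ∧
      -- the generator of `ℤ₂` acts as matrix transposition
      ((Φ (SemidirectProduct.inr (Multiplicative.ofAdd 1)) :
        Sym3 (Mat 3) ≃ₗ[ℂ] Sym3 (Mat 3)) = transposition 3) ∧
      -- the left factor acts on the first block by affine transformations of the labels
      (∀ (v : Label) (M : SL(2, ZMod 3)) (x : Label),
        (Φ (SemidirectProduct.inl (AffineSL.mk v M)) : Sym3 (Mat 3) ≃ₗ[ℂ] Sym3 (Mat 3))
          (cube (firstBlock x)) = cube (firstBlock (M.1 *ᵥ x + v))) ∧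
      -- and on the second block by their linear parts
      (∀ (v : Label) (M : SL(2, ZMod 3)) (x : Label),
        (Φ (SemidirectProduct.inl (AffineSL.mk v M)) : Sym3 (Mat 3) ≃ₗ[ℂ] Sym3 (Mat 3))
          (cube (secondBlock x)) = cube (secondBlock (M.1 *ᵥ x)))) ∧
    -- the column spaces of the first block form the Hesse configuration
    (∀ x : Label, Module.finrank ℂ (columnSpace x) = 1) ∧
    Function.Injective columnSpace ∧
    (∀ x y z : Label, x ≠ y → x ≠ z → y ≠ z →
      (columnSpace z ≤ columnSpace x ⊔ columnSpace y ↔ x + y + z = 0)) := by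
  refine ⟨ncard_decompositionSet, (Nat.card_congr hesseEquiv.toEquiv).symm.trans card_hesseGroup,
    ⟨hesseEquiv, fun γ => ⟨fun hγ => ?_, ?_⟩, ?_, fun v M x => ?_, fun v M x => ?_⟩,
    finrank_columnSpace, columnSpace_injective,
    fun _ _ _ hxy hxz hyz => columnSpace_le_sup_iff hxy hxz hyz⟩
  · obtain ⟨h, rfl⟩ := hesseEquiv.surjective γ
    obtain ⟨g, rfl⟩ := exists_eq_inl_of_mem_pglSubgroup hγ
    exact ⟨g, rfl⟩
  · rintro ⟨g, rfl⟩
    rw [coe_hesseEquiv, hessePerm_inl]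
    exact cubeRep_affinePerm_mem_pglSubgroup g
  · rw [coe_hesseEquiv, hessePerm_inr_one, cubeRep_swapPerm]
  · rw [coe_hesseEquiv, hessePerm_inl, cubeRep_firstBlock, affinePerm_mk]
  · rw [coe_hesseEquiv, hessePerm_inl, cubeRep_affinePerm_secondBlock]
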